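/- **Setting.** Let $N$ be a finite horizon and let $E$ (states) and $A$ (actions) be Borel spaces. For $n=0,\dots,N-1$ let $D_n\subseteq E\times A$ be measurable and contain the graph of a measurable map $E\to A$, and put $D_n(x)=\{a:(x,a)\in D_n\}$. Let $(\mathcal Z,\mathfrak Z)$ be a measurable space, $T_n:D_n\times\mathcal Z\to E$ measurable, $c_n:D_n\times E\to\mathbb R$ and $c_N:E\to\mathbb R$. The disturbances $Z_1,\dots,Z_N$ are independent with separable laws $\mathbb P_1,\dots,\mathbb P_N$ on $\mathcal Z$. Fix $q\in(1,\infty]$ and $p$ with $\frac1p+\frac1q=1$. For $n=1,\dots,N$ let $\mathcal Q_n$ be a non-empty set of probability measures $\mathbb Q\ll\mathbb P_n$ with $d\mathbb Q/d\mathbb P_n\in L^q(\mathbb P_n)$. Via densities $\mathcal Q_n$ is viewed as a subset of $L^q(\mathbb P_n)$, with the trace of the weak* topology $\sigma(L^q,L^p)$ and its Borel $\sigma$-algebra. **Policies.** $\mathcal H_n$ is the set of histories $h_n=(x_0,a_0,x_1,\dots,x_n)$ with $a_k\in D_k(x_k)$. A deterministic Markov policy of the controller is $\pi=(d_0,\dots,d_{N-1})$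 with $d_n:E\to A$ measurable and $d_n(x)\in D_n(x)$. A policy of nature, $\gamma\in\Gamma$, is a sequence of measurable maps $\gamma_n:\{(h_n,a_n):h_n\in\mathcal H_n,\ a_n\in D_n(x_n)\}\to\mathcal Q_{n+1}$, $n=0,\dots,N-1$. A Markov policy of nature, $\gamma\in\Gamma^M$, is a sequence of measurable maps $\gamma_n:D_n\to\mathcal Q_{n+1}$; it is regarded as an element of $\Gamma$ by $\gamma_n(h_n,a_n)=\gamma_n(x_n,a_n)$. **Values.** Under $(\pi,\gamma)$, given $h_n$ one has $a_n=d_n(x_n)$ and $x_{n+1}=T_n(x_n,a_n,z_{n+1})$ with $z_{n+1}\sim\gamma_n(h_n,a_n)$, and so on up to time $N$. For $n\le N$, $V_{n\pi\gamma}(h_n)$ is the expectation, under the resulting law of motion started from $h_n$ at time $n$, of $\sum_{k=n}^{N-1}c_k(X_k,A_k,X_{k+1})+c_N(X_N)$, and $V_{n\pi}(h_n)=\sup_{\gamma\in\Gamma}V_{n\pi\gamma}(h_n)$. For $\gamma\in\Gamma^M$ let $J_{N\pi\gamma}=c_N$ and $$J_{n\pi\gamma}(x)=\int c_n\big(x,d_n(x),T_n(x,d_n(x),z)\big)+J_{n+1,\pi\gamma}\big(T_n(x,d_n(x),z)\big)\,\gamma_n(x,d_n(x))(dz),$$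 and let $J_{n\pi}(x)=\sup_{\gamma\in\Gamma^M}J_{n\pi\gamma}(x)$. For $v:E\to\mathbb R$ let $$\mathcal T_{nd_n}v(x)=\sup_{\mathbb Q\in\mathcal Q_{n+1}}\int c_n\big(x,d_n(x),T_n(x,d_n(x),z)\big)+v\big(T_n(x,d_n(x),z)\big)\,\mathbb Q(dz).$$ **Assumptions.** 1. For $n<N$: every $D_n(x)$ is compact, and if $x_k\to x$ and $a_k\in D_n(x_k)$ then $(a_k)$ has an accumulation point in $D_n(x)$; $T_n(x,a,z)$ is continuous in $(x,a)\in D_n$ for each $z$; $c_n$ and $c_N$ are lower semicontinuous. 2. There are $\alpha,\underline\epsilon,\bar\epsilon\ge0$ with $\underline\epsilon+\bar\epsilon=1$, $\alpha\ne1$, and measurable $\underline b:E\to(-\infty,-\underline\epsilon]$, $\bar b:E\to[\bar\epsilon,\infty)$ with $\underline b\le c_N\le\bar b$ such that for all $n<N$, $\mathbb Q\in\mathcal Q_{n+1}$, $(x,a)\in D_n$, writing $Y=T_n(x,a,Z_{n+1})$: $\mathbb E^{\mathbb Q}[-c_n^-(x,a,Y)]\ge\underline b(x)$, $\mathbb E^{\mathbb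 Q}[\underline b(Y)]\ge\alpha\underline b(x)$, $\mathbb E^{\mathbb Q}[c_n^+(x,a,Y)]\le\bar b(x)$, $\mathbb E^{\mathbb Q}[\bar b(Y)]\le\alpha\bar b(x)$. Moreover, with $b=\bar b-\underline b$, every point of $D_n$ ($n<N$) has a neighbourhood $U$ in $D_n$ and measurable $\Theta_1,\Theta_2:\mathcal Z\to[0,\infty)$ in $L^p(\mathbb P_{n+1})$ with $|c_n(x,a,T_n(x,a,z))|\le\Theta_1(z)$ and $b(T_n(x,a,z))\le\Theta_2(z)$ for all $z\in\mathcal Z$, $(x,a)\in U$. 3. The sets $\mathcal Q_1,\dots,\mathcal Q_N$ are bounded in $L^q$-norm by a common constant. **Claim.** Let $\pi=(d_0,\dots,d_{N-1})$ be a deterministic Markov policy of the controller. All integrals and suprema in the definitions of $V_{n\pi\gamma}$, $V_{n\pi}$, $J_{n\pi}$ and $\mathcal T_{nd_n}J_{n+1,\pi}$ exist and are finite, and $J_{n\pi\gamma}(x_n)=V_{n\pi\gamma}(h_n)$ for $\gamma\in\Gamma^M$. Furthermore: (a) $J_{n\pi}(x_n)=V_{n\pi}(h_n)$ for all $n=0,\dots,N$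 and $h_n\in\mathcal H_n$. (b) $J_{n\pi}(x)=\mathcal T_{nd_n}J_{n+1,\pi}(x)$ for all $n=0,\dots,N-1$ and $x\in E$. (c) For every $\varepsilon>0$ there is $\gamma\in\Gamma^M$ with $J_{n\pi\gamma}(x)\ge J_{n\pi}(x)-\varepsilon$ and $V_{n\pi\gamma}(h_n)\ge V_{n\pi}(h_n)-\varepsilon$ for all $n=0,\dots,N$, $x\in E$, $h_n\in\mathcal H_n$. (d) If $\mathcal Q_1,\dots,\mathcal Q_N$ are weak* closed in $L^q$, there is $\gamma\in\Gamma^M$ with $J_{n\pi\gamma}=J_{n\pi}$ and $V_{n\pi\gamma}=V_{n\pi}$ for all $n=0,\dots,N$. -/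

import Mathlib

open MeasureTheory ProbabilityTheory Topology
open scoped ENNReal NNReal

/-! ### Ambiguity: probability measures with density in `L^q`, and the weak* topology -/

/-- The weak* topology `σ(L^q, L^p)` on `L^q(μ)`, `1/p + 1/q = 1`: the coarsest topology making
`g ↦ ∫ g Y dμ` continuous for every `Y ∈ L^p(μ)`. -/
@[reducible] noncomputable def weakStarTopology {Z : Type*} [MeasurableSpace Z] (q : ℝ≥0∞) (μ : Measure Z) :
    TopologicalSpace (Lp ℝ q μ) :=
  TopologicalSpace.induced
    (fun (g : Lp ℝ q μ) (Y : Lp ℝ (ENNReal.conjExponent q) μ) => ∫ z, g z * Y z ∂μ)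
    inferInstance

/-- The set `ℳ^q(Z, μ)` of probability measures `Q ≪ μ` whose density `dQ/dμ` lies in `L^q(μ)`. -/
structure DensityMeasure {Z : Type*} [MeasurableSpace Z] (q : ℝ≥0∞) (μ : Measure Z) where
  toMeasure : Measure Z
  isProb : IsProbabilityMeasure toMeasure
  ac : toMeasure ≪ μ
  memLp : MemLp (fun z => (toMeasure.rnDeriv μ z).toReal) q μ

namespace DensityMeasure

variable {Z : Type*} [MeasurableSpace Z] {q : ℝ≥0∞} {μ : Measure Z}

instance (Q : DensityMeasure q μ) : IsProbabilityMeasure Q.toMeasure := Q.isProb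

/-- The density `dQ/dμ` as an element of `L^q(μ)`. -/
noncomputable def density (Q : DensityMeasure q μ) : Lp ℝ q μ := Q.memLp.toLp

/-- `ℳ^q(Z, μ)`, identified with a subset of `L^q(μ)` through densities, carries the trace of the
weak* topology. -/
noncomputable instance : TopologicalSpace (DensityMeasure q μ) :=
  TopologicalSpace.induced density (weakStarTopology q μ)

noncomputable instance : MeasurableSpace (DensityMeasure q μ) := borel _

instance : BorelSpace (DensityMeasure q μ) := ⟨rfl⟩

/-- Evaluation of the measure is measurable for the weak* Borel `σ`-algebra, so that measurable
maps into `ℳ^q(Z, μ)` are stochastic kernels. -/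
theorem measurable_toMeasure [IsProbabilityMeasure μ] :
    Measurable (toMeasure : DensityMeasure q μ → Measure Z) := by
  refine Measure.measurable_of_measurable_coe _ fun s hs => ?_
  let Y : Lp ℝ (ENNReal.conjExponent q) μ :=
    indicatorConstLp (ENNReal.conjExponent q) hs (measure_ne_top μ s) (1 : ℝ)
  have hcont : Continuous fun Q : DensityMeasure q μ => ∫ z, Q.density z * Y z ∂μ := by
    have h1 : Continuous[weakStarTopology q μ, inferInstance]
        (fun (g : Lp ℝ q μ) (Y : Lp ℝ (ENNReal.conjExponent q) μ) => ∫ z, g z * Y z ∂μ) :=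
      continuous_induced_dom
    have h2 : Continuous[inferInstance, weakStarTopology q μ]
        (density : DensityMeasure q μ → Lp ℝ q μ) := continuous_induced_dom
    exact (continuous_apply Y).comp (@Continuous.comp _ _ _ _ (weakStarTopology q μ) _ _ _ h1 h2)
  have heq : (fun Q : DensityMeasure q μ => Q.toMeasure s) =
      fun Q => ENNReal.ofReal (∫ z, Q.density z * Y z ∂μ) := by
    funext Q
    have h1 : ∫ z, Q.density z * Y z ∂μ = ∫ z in s, (Q.toMeasure.rnDeriv μ z).toReal ∂μ := by
      rw [← integral_indicator hs]
      refine integral_congr_ae ?_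
      filter_upwards [Q.memLp.coeFn_toLp,
        indicatorConstLp_coeFn (p := ENNReal.conjExponent q) (hs := hs)
          (hμs := measure_ne_top μ s) (c := (1 : ℝ))] with z hz1 hz2
      have hz1' : Q.density z = (Q.toMeasure.rnDeriv μ z).toReal := hz1
      have hz2' : Y z = s.indicator (fun _ => (1 : ℝ)) z := hz2
      rw [hz1', hz2']
      by_cases hzs : z ∈ s <;> simp [hzs]
    rw [h1, Measure.setIntegral_toReal_rnDeriv Q.ac, measureReal_def,
      ENNReal.ofReal_toReal (measure_ne_top _ _)]
  rw [heq]
  exact hcont.measurable.ennreal_ofReal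

end DensityMeasure

/-! ### The decision model -/

/-- Data of the decision model with planning horizon `N`. The stages that matter are
`n = 0, …, N - 1`; the data at later indices play no role. `P n` is the law of the disturbance
`Z_{n+1}` that drives the transition from time `n` to time `n + 1`, and `𝒬 n` is the ambiguity set
for that disturbance. -/
structure RobustMDP (E A Z : Type*) [MeasurableSpace E] [MeasurableSpace A] [MeasurableSpace Z]
    (q : ℝ≥0∞) where
  /-- planning horizon -/
  N : ℕ
  /-- admissible state-action pairs -/
  D : ℕ → Set (E × A)
  measurableSet_D : ∀ n, MeasurableSet (D n)
  exists_selector : ∀ n, ∃ f : E → A, Measurable f ∧ ∀ x, (x, f x) ∈ D n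
  /-- transition functions -/
  T : ∀ n, D n × Z → E
  measurable_T : ∀ n, Measurable (T n)
  /-- one-stage costs -/
  c : ∀ n, D n × E → ℝ
  /-- terminal cost -/
  cN : E → ℝ
  /-- disturbance laws -/
  P : ℕ → Measure Z
  isProb_P : ∀ n, IsProbabilityMeasure (P n)
  /-- ambiguity sets -/
  𝒬 : ∀ n, Set (DensityMeasure q (P n))
  nonempty_𝒬 : ∀ n, (𝒬 n).Nonempty

namespace RobustMDP

section Model

variable {E A Z : Type*} [MeasurableSpace E] [MeasurableSpace A] [MeasurableSpace Z] {q : ℝ≥0∞}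
  (M : RobustMDP E A Z q)

instance (n : ℕ) : IsProbabilityMeasure (M.P n) := M.isProb_P n

/-- Feasible histories `(x_0, a_0, x_1, …, a_{n-1}, x_n)`: the states `x_0, …, x_n` and the actions
`a_0, …, a_{n-1}`, with `a_k ∈ D_k(x_k)`. -/
abbrev Hist (n : ℕ) : Type _ :=
  {h : (Fin (n + 1) → E) × (Fin n → A) // ∀ k : Fin n, (h.1 k.castSucc, h.2 k) ∈ M.D k}

variable {M}

/-- The current state `x_n` of a history. -/
def Hist.last {n : ℕ} (h : M.Hist n) : E := h.1.1 (Fin.last n)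

/-- The state `x_k` of a history. -/
def Hist.state {n : ℕ} (h : M.Hist n) (k : Fin (n + 1)) : E := h.1.1 k

/-- The pair `(x_k, a_k) ∈ D_k` of a history. -/
def Hist.stateAction {n : ℕ} (h : M.Hist n) (k : Fin n) : M.D k :=
  ⟨(h.1.1 k.castSucc, h.1.2 k), h.2 k⟩

theorem Hist.measurable_last {n : ℕ} : Measurable (Hist.last : M.Hist n → E) :=
  (measurable_pi_apply _).comp (measurable_fst.comp measurable_subtype_coe)

variable (M)

/-- Pairs `(h_n, a_n)` of a feasible history and an action `a_n ∈ D_n(x_n)`. -/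
abbrev HistAction (n : ℕ) : Type _ := {p : M.Hist n × A // (p.1.last, p.2) ∈ M.D n}

theorem measurableSet_histAction (n : ℕ) :
    MeasurableSet {p : M.Hist n × A | (p.1.last, p.2) ∈ M.D n} :=
  ((Hist.measurable_last.comp measurable_fst).prodMk measurable_snd) (M.measurableSet_D n)

variable {M}

/-- The pair `(x_n, a_n) ∈ D_n` belonging to `(h_n, a_n)`. -/
def HistAction.current {n : ℕ} (p : M.HistAction n) : M.D n := ⟨(p.1.1.last, p.1.2), p.2⟩

theorem HistAction.measurable_current {n : ℕ} :
    Measurable (HistAction.current : M.HistAction n → M.D n) :=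
  (((Hist.measurable_last.comp measurable_fst).prodMk measurable_snd).comp
    measurable_subtype_coe).subtype_mk

/-- The history `(h_n, a_n, x')`. -/
def HistAction.extend {n : ℕ} (p : M.HistAction n × E) : M.Hist (n + 1) :=
  ⟨(Fin.snoc (α := fun _ => E) p.1.1.1.1.1 p.2, Fin.snoc (α := fun _ => A) p.1.1.1.1.2 p.1.1.2), by
    intro k
    refine Fin.lastCases ?_ (fun k => ?_) k
    · simp only [Fin.snoc_castSucc, Fin.snoc_last]
      exact p.1.2
    · simp only [Fin.snoc_castSucc]
      exact p.1.1.1.2 k⟩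

theorem HistAction.measurable_extend {n : ℕ} :
    Measurable (HistAction.extend : M.HistAction n × E → M.Hist (n + 1)) := by
  refine Measurable.subtype_mk (Measurable.prodMk ?_ ?_)
  · refine measurable_pi_iff.2 fun k => ?_
    refine Fin.lastCases ?_ (fun k => ?_) k
    · simpa only [Fin.snoc_last] using measurable_snd
    · simp only [Fin.snoc_castSucc]
      fun_prop
  · refine measurable_pi_iff.2 fun k => ?_
    refine Fin.lastCases ?_ (fun k => ?_) k
    · simp only [Fin.snoc_last]
      fun_prop
    · simp only [Fin.snoc_castSucc]
      fun_prop

variable (M)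

/-! ### Policies -/

/-- Randomized (history-dependent) policies of the controller. -/
structure RandomizedPolicy where
  kernel : ∀ n, Kernel (M.Hist n) A
  isMarkovKernel : ∀ n, IsMarkovKernel (kernel n)
  feasible : ∀ n (h : M.Hist n), kernel n h {a | (h.last, a) ∈ M.D n} = 1

/-- Deterministic Markov policies of the controller. -/
structure MarkovPolicy where
  rule : ℕ → E → A
  measurable_rule : ∀ n, Measurable (rule n)
  feasible : ∀ n x, (x, rule n x) ∈ M.D n

/-- (History-dependent) policies of nature: decision rules `γ_n`, measurable for the Borel
`σ`-algebra of the weak* topology on the ambiguity set. -/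
structure NaturePolicy where
  rule : ∀ n, M.HistAction n → M.𝒬 n
  measurable_rule : ∀ n, Measurable (rule n)

/-- Markov policies of nature. -/
structure MarkovNaturePolicy where
  rule : ∀ n, M.D n → M.𝒬 n
  measurable_rule : ∀ n, Measurable (rule n)

variable {M}

/-- A deterministic Markov policy as a randomized policy, through Dirac kernels. -/
noncomputable def MarkovPolicy.toRandomized (d : M.MarkovPolicy) : M.RandomizedPolicy where
  kernel n := Kernel.deterministic (fun h : M.Hist n => d.rule n h.last)
    ((d.measurable_rule n).comp Hist.measurable_last)
  isMarkovKernel _ := inferInstance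
  feasible n h := by
    have hs : MeasurableSet {a : A | (h.last, a) ∈ M.D n} :=
      measurable_prodMk_left (M.measurableSet_D n)
    rw [Kernel.deterministic_apply' _ _ hs]
    simp [d.feasible n h.last]

/-- A Markov policy of nature as a policy of nature. -/
def MarkovNaturePolicy.toNature (γ : M.MarkovNaturePolicy) : M.NaturePolicy where
  rule n p := γ.rule n p.current
  measurable_rule n := (γ.measurable_rule n).comp HistAction.measurable_current

/-- The pair `(x, d_n(x)) ∈ D_n`. -/
def MarkovPolicy.pair (d : M.MarkovPolicy) (n : ℕ) (x : E) : M.D n :=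
  ⟨(x, d.rule n x), d.feasible n x⟩

/-! ### Law of motion and values of history-dependent policies -/

/-- The stochastic kernel `γ_n(dz | h_n, a_n)` induced by a decision rule of nature. -/
noncomputable def NaturePolicy.kernel (γ : M.NaturePolicy) (n : ℕ) :
    Kernel (M.HistAction n) Z where
  toFun p := (γ.rule n p).1.toMeasure
  measurable' := DensityMeasure.measurable_toMeasure.comp
    (measurable_subtype_coe.comp (γ.measurable_rule n))

instance (γ : M.NaturePolicy) (n : ℕ) : IsMarkovKernel (γ.kernel n) :=
  ⟨fun p => (γ.rule n p).1.isProb⟩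

instance (π : M.RandomizedPolicy) (n : ℕ) : IsMarkovKernel (π.kernel n) := π.isMarkovKernel n

/-- The transition kernel `Q_n^γ(dx' | h_n, a_n)`: the law of `T_n(x_n, a_n, z)` for
`z ∼ γ_n(· | h_n, a_n)`. -/
noncomputable def NaturePolicy.transition (γ : M.NaturePolicy) (n : ℕ) :
    Kernel (M.HistAction n) E :=
  (Kernel.id ×ₖ γ.kernel n).map fun p => M.T n (p.1.current, p.2)

/-- The kernel `h_n ↦ δ_{h_n} ⊗ π_n` on pairs `(h_n, a_n)` with `a_n ∈ D_n(x_n)`. -/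
noncomputable def RandomizedPolicy.histAction (π : M.RandomizedPolicy) (n : ℕ) :
    Kernel (M.Hist n) (M.HistAction n) :=
  (Kernel.id ×ₖ π.kernel n).comapRight
    (MeasurableEmbedding.subtype_coe (s := {p : M.Hist n × A | (p.1.last, p.2) ∈ M.D n})
      (M.measurableSet_histAction n))

/-- The kernel `h_n ↦ δ_{h_n} ⊗ π_n ⊗ Q_n^γ` from histories up to time `n` to histories up to time
`n + 1`. -/
noncomputable def step (π : M.RandomizedPolicy) (γ : M.NaturePolicy) (n : ℕ) :
    Kernel (M.Hist n) (M.Hist (n + 1)) :=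
  ((Kernel.id ×ₖ γ.transition n) ∘ₖ π.histAction n).map HistAction.extend

/-- The kernel `h_n ↦ δ_{h_n} ⊗ π_n ⊗ Q_n^γ ⊗ ⋯ ⊗ π_{n+k-1} ⊗ Q_{n+k-1}^γ`, the law of motion up to
time `n + k` given the history `h_n`. -/
noncomputable def law (π : M.RandomizedPolicy) (γ : M.NaturePolicy) (n : ℕ) :
    ∀ k : ℕ, Kernel (M.Hist n) (M.Hist (n + k))
  | 0 => Kernel.id
  | k + 1 => step π γ (n + k) ∘ₖ law π γ n k

/-- The cost `∑_{k=n}^{m-1} c_k(x_k, a_k, x_{k+1}) + c_N(x_m)` of a history up to time `m`. -/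
noncomputable def Hist.cost {m : ℕ} (n : ℕ) (h : M.Hist m) : ℝ :=
  (∑ k : Fin m, if n ≤ k then M.c k (h.stateAction k, h.state k.succ) else 0) + M.cN h.last

/-- `V_{nπγ}(h_n)`, `n ≤ N`: the expected cost from time `n` to the horizon `N = n + (N - n)` given
the history `h_n`. -/
noncomputable def V (π : M.RandomizedPolicy) (γ : M.NaturePolicy) (n : ℕ) (h : M.Hist n) : ℝ :=
  ∫ h', h'.cost n ∂(law π γ n (M.N - n) h)

/-- The robust value `V_{nπ}(h_n) = sup_γ V_{nπγ}(h_n)` over all policies of nature. -/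
noncomputable def robustV (π : M.RandomizedPolicy) (n : ℕ) (h : M.Hist n) : ℝ :=
  ⨆ γ : M.NaturePolicy, V π γ n h

/-! ### Operators and values of Markov policies -/

variable (M)

/-- `z ↦ c_n(x, a, T_n(x, a, z)) + v(T_n(x, a, z))`. -/
def stageCost (n : ℕ) (v : E → ℝ) (xa : M.D n) (z : Z) : ℝ :=
  M.c n (xa, M.T n (xa, z)) + v (M.T n (xa, z))

/-- `L_n v(x, a, Q)`. -/
noncomputable def L (n : ℕ) (v : E → ℝ) (xa : M.D n) (Q : DensityMeasure q (M.P n)) : ℝ :=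
  ∫ z, M.stageCost n v xa z ∂Q.toMeasure

variable {M}

/-- `𝒯_{n d_n γ_n} v(x) = L_n v(x, d_n(x), γ_n(x, d_n(x)))`. -/
noncomputable def opNature (d : M.MarkovPolicy) (γ : M.MarkovNaturePolicy) (n : ℕ) (v : E → ℝ)
    (x : E) : ℝ :=
  M.L n v (d.pair n x) (γ.rule n (d.pair n x)).1

/-- `𝒯_{n d_n} v(x) = sup_{Q ∈ 𝒬_{n+1}} L_n v(x, d_n(x), Q)`. -/
noncomputable def opRobust (d : M.MarkovPolicy) (n : ℕ) (v : E → ℝ) (x : E) : ℝ :=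
  ⨆ Q : M.𝒬 n, M.L n v (d.pair n x) Q.1

/-- Value of a pair of Markov policies at time `n` with `k` remaining stages. -/
noncomputable def valueToGo (d : M.MarkovPolicy) (γ : M.MarkovNaturePolicy) : ℕ → ℕ → E → ℝ
  | 0, _ => M.cN
  | k + 1, n => opNature d γ n (valueToGo d γ k (n + 1))

/-- `J_{nπγ}`, `n ≤ N`: `J_{Nπγ} = c_N` and `J_{nπγ} = 𝒯_{n d_n γ_n} J_{n+1,πγ}`. -/
noncomputable def J (d : M.MarkovPolicy) (γ : M.MarkovNaturePolicy) (n : ℕ) : E → ℝ :=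
  valueToGo d γ (M.N - n) n

/-- `J_{nπ}(x) = sup_γ J_{nπγ}(x)` over Markov policies of nature. -/
noncomputable def robustJ (d : M.MarkovPolicy) (n : ℕ) (x : E) : ℝ :=
  ⨆ γ : M.MarkovNaturePolicy, J d γ n x

end Model

/-! ### Assumptions -/

section Assumptions

variable {E A Z : Type*} [MeasurableSpace E] [MeasurableSpace A] [MeasurableSpace Z] {q : ℝ≥0∞}
  [TopologicalSpace E] [TopologicalSpace A] (M : RobustMDP E A Z q)

/-- Continuity and compactness: compact-valued, upper semicontinuous `D_n`; continuous transition
functions; lower semicontinuous costs. -/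
structure ContinuityCompactness : Prop where
  compact : ∀ n < M.N, ∀ x, IsCompact {a | (x, a) ∈ M.D n}
  usc : ∀ n < M.N, ∀ (x : ℕ → E) (a : ℕ → A) (x₀ : E),
    Filter.Tendsto x Filter.atTop (𝓝 x₀) → (∀ k, (x k, a k) ∈ M.D n) →
      ∃ a₀, (x₀, a₀) ∈ M.D n ∧ MapClusterPt a₀ Filter.atTop a
  continuous_T : ∀ n < M.N, ∀ z, Continuous fun xa : M.D n => M.T n (xa, z)
  lsc_c : ∀ n < M.N, LowerSemicontinuous (M.c n)
  lsc_cN : LowerSemicontinuous M.cN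

/-- Integrability assumptions for given `α` and given lower and upper bounding functions `bl ≤ 0`
and `bu ≥ 0`. Expectations of the nonnegative functions `c_n^-`, `c_n^+`, `-bl`, `bu` are Lebesgue
integrals with values in `[0, ∞]`, so that the bounds contain the finiteness of the expectations. -/
structure BoundingFunctions (α : ℝ) (bl bu : E → ℝ) : Prop where
  α_nonneg : 0 ≤ α
  α_ne_one : α ≠ 1
  measurable_lower : Measurable bl
  measurable_upper : Measurable bu
  bounds : ∃ εl εu : ℝ, 0 ≤ εl ∧ 0 ≤ εu ∧ εl + εu = 1 ∧ (∀ x, bl x ≤ -εl) ∧ ∀ x, εu ≤ bu x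
  cost_neg : ∀ n < M.N, ∀ Q ∈ M.𝒬 n, ∀ xa : M.D n,
    ∫⁻ z, ENNReal.ofReal (-M.c n (xa, M.T n (xa, z))) ∂Q.toMeasure ≤ ENNReal.ofReal (-bl xa.1.1)
  lower : ∀ n < M.N, ∀ Q ∈ M.𝒬 n, ∀ xa : M.D n,
    ∫⁻ z, ENNReal.ofReal (-bl (M.T n (xa, z))) ∂Q.toMeasure ≤ ENNReal.ofReal (α * -bl xa.1.1)
  cost_pos : ∀ n < M.N, ∀ Q ∈ M.𝒬 n, ∀ xa : M.D n,
    ∫⁻ z, ENNReal.ofReal (M.c n (xa, M.T n (xa, z))) ∂Q.toMeasure ≤ ENNReal.ofReal (bu xa.1.1)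
  upper : ∀ n < M.N, ∀ Q ∈ M.𝒬 n, ∀ xa : M.D n,
    ∫⁻ z, ENNReal.ofReal (bu (M.T n (xa, z))) ∂Q.toMeasure ≤ ENNReal.ofReal (α * bu xa.1.1)
  terminal : ∀ x, bl x ≤ M.cN x ∧ M.cN x ≤ bu x
  /-- Local `L^p` domination of the costs and of `b = bu - bl`. A closed ball for a product metric,
  intersected with `D_n`, is replaced by a neighbourhood in `D_n`, which amounts to the same. -/
  domination : ∀ n < M.N, ∀ xa₀ : M.D n, ∃ U ∈ 𝓝 xa₀, ∃ Θ₁ Θ₂ : Z → ℝ,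
    Measurable Θ₁ ∧ Measurable Θ₂ ∧ (∀ z, 0 ≤ Θ₁ z) ∧ (∀ z, 0 ≤ Θ₂ z) ∧
    MemLp Θ₁ (ENNReal.conjExponent q) (M.P n) ∧ MemLp Θ₂ (ENNReal.conjExponent q) (M.P n) ∧
    ∀ z, ∀ xa ∈ U, |M.c n (xa, M.T n (xa, z))| ≤ Θ₁ z ∧
      bu (M.T n (xa, z)) - bl (M.T n (xa, z)) ≤ Θ₂ z

/-- The ambiguity sets are norm bounded in `L^q`, uniformly in the stage. -/
def NormBounded : Prop :=
  ∃ K : ℝ≥0, ∀ n < M.N, ∀ Q ∈ M.𝒬 n, eLpNorm Q.density q (M.P n) ≤ K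

/-- The ambiguity sets, viewed as subsets of `L^q`, are weak* closed. -/
def WeakStarClosed : Prop :=
  ∀ n < M.N, IsClosed[weakStarTopology q (M.P n)] (DensityMeasure.density '' M.𝒬 n)

end Assumptions

end RobustMDP

/-! Let W be robust value iteration: W_N = c_N and W_n = 𝒯_{n d_n} W_{n+1} (`robustIteration`).
Everything follows by comparing values with W. If nature plays any policy, even a history-dependent
one, then the cost accumulated so far plus W at the current state has nonincreasing expectation,
because W_n is a supremum over the ambiguity set; hence V ≤ W (`V_le_robustIteration`). Backward
induction gives J ≤ W in the same way. Conversely, a Markov rule losing at most δ in each one-stage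
supremum has J_n ≥ W_n - (N - n)δ (`robustIteration_sub_le_J`). With δ arbitrarily small, both
suprema equal W, which gives (a), (b) and (c); δ = 0 gives (d).

The difficulty is measurability, of W and of nature's almost worst measures. The state enters a
stage only through the class of the stage cost in L^p. That class depends measurably on the
state-action pair (`measurable_toLp`), so it suffices to treat the worst-case expectation as a
functional of Y ∈ L^p. It is a supremum of continuous functionals, hence lower semicontinuous and
measurable. By Hölder and the norm bound these functionals are equi-Lipschitz, and L^p is separable,
so almost worst measures can be chosen with countably many values
(`exists_measurable_almost_worst`).

If the ambiguity set is weak* closed, it is weak* compact: Tychonoff's theorem yields a limiting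
positive functional on L^p, which is represented by an L^q density
(`exists_Lp_of_nonneg_functional`). Exact maximizers are then chosen by lexicographic maximization
along a dense sequence of L^p, which leaves a single measure (`exists_measurable_argmax`).

Integrability comes from the bounding functions: W_n and J_n stay between C bl and C bu, and one
stage replaces C by 1 + Cα. -/

/-! ### Representation of positive functionals on L^p -/

section PositiveFunctional

variable {Z : Type*} [MeasurableSpace Z] {μ : Measure Z} [IsProbabilityMeasure μ]
  {p q : ℝ≥0∞}

/-- The indicator function of a measurable set, as an element of `L^p` of a probability measure. -/
noncomputable def unitIndicatorLp (p : ℝ≥0∞) (μ : Measure Z) [IsProbabilityMeasure μ] {s : Set Z}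
    (hs : MeasurableSet s) : Lp ℝ p μ :=
  indicatorConstLp p hs (measure_ne_top μ s) (1 : ℝ)

theorem unitIndicatorLp_union {s t : Set Z} (hs : MeasurableSet s) (ht : MeasurableSet t)
    (hst : Disjoint s t) :
    unitIndicatorLp p μ (hs.union ht) = unitIndicatorLp p μ hs + unitIndicatorLp p μ ht :=
  indicatorConstLp_disjoint_union hs ht (measure_ne_top μ s) (measure_ne_top μ t) hst 1

theorem unitIndicatorLp_congr {s t : Set Z} (hs : MeasurableSet s) (ht : MeasurableSet t)
    (h : s = t) : unitIndicatorLp p μ hs = unitIndicatorLp p μ ht := by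
  subst h; rfl

theorem unitIndicatorLp_empty : unitIndicatorLp p μ (MeasurableSet.empty : MeasurableSet (∅ : Set Z))
    = 0 :=
  indicatorConstLp_empty

theorem measurableSet_iUnion_lt {f : ℕ → Set Z} (hf : ∀ i, MeasurableSet (f i)) (n : ℕ) :
    MeasurableSet (⋃ i < n, f i) :=
  .iUnion fun i => .iUnion fun _ => hf i

/-- The error lives on the tail of the disjoint union, whose measure tends to zero. For p < ∞ small
sets have small indicators in L^p; this is what makes the set function of a functional countably
additive. -/
theorem tendsto_unitIndicatorLp_iUnion [Fact (1 ≤ p)] (hp : p ≠ ∞) {f : ℕ → Set Z}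
    (hf : ∀ i, MeasurableSet (f i)) (hd : Pairwise (Function.onFun Disjoint f)) :
    Filter.Tendsto (fun n => unitIndicatorLp p μ (measurableSet_iUnion_lt hf n)) Filter.atTop
      (𝓝 (unitIndicatorLp p μ (MeasurableSet.iUnion hf))) := by
  refine tendsto_indicatorConstLp_set hp ?_
  refine tendsto_of_tendsto_of_tendsto_of_le_of_le tendsto_const_nhds
    (tendsto_measure_biUnion_Ici_zero_of_pairwise_disjoint (μ := μ)
      (fun i => (hf i).nullMeasurableSet) hd) (fun _ => zero_le) fun n => measure_mono ?_
  rintro z (⟨h1, h2⟩ | ⟨h1, h2⟩)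
  · simp only [Set.mem_iUnion] at h1 h2
    obtain ⟨i, -, hi⟩ := h1
    exact absurd ⟨i, hi⟩ h2
  · simp only [Set.mem_iUnion] at h1 h2 ⊢
    obtain ⟨i, hi⟩ := h1
    exact ⟨i, not_lt.1 fun h => h2 ⟨i, h, hi⟩, hi⟩

/-- A positive functional on `L^p`, `p < ∞`, defines a measure. -/
theorem exists_measure_of_nonneg_functional [Fact (1 ≤ p)] (hp : p ≠ ∞) (Φ : Lp ℝ p μ →L[ℝ] ℝ)
    (hΦ : ∀ s (hs : MeasurableSet s), 0 ≤ Φ (unitIndicatorLp p μ hs)) :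
    ∃ ν : Measure Z, ∀ s (hs : MeasurableSet s), ν s = ENNReal.ofReal (Φ (unitIndicatorLp p μ hs)) := by
  refine ⟨Measure.ofMeasurable (fun s hs => ENNReal.ofReal (Φ (unitIndicatorLp p μ hs))) ?_ ?_,
    fun s hs => Measure.ofMeasurable_apply s hs⟩
  · simp [unitIndicatorLp_empty]
  · intro f hf hd
    have hsum : ∀ n, ∑ i ∈ Finset.range n, ENNReal.ofReal (Φ (unitIndicatorLp p μ (hf i))) =
        ENNReal.ofReal (Φ (unitIndicatorLp p μ (measurableSet_iUnion_lt hf n))) := by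
      intro n
      induction n with
      | zero =>
        have : unitIndicatorLp p μ (measurableSet_iUnion_lt hf 0) = 0 := by
          rw [unitIndicatorLp_congr _ MeasurableSet.empty (by simp), unitIndicatorLp_empty]
        rw [this]
        simp
      | succ n ih =>
        have hdis : Disjoint (⋃ i < n, f i) (f n) := by
          simp only [Set.disjoint_iUnion_left]
          exact fun i hi => hd hi.ne
        have : unitIndicatorLp p μ (measurableSet_iUnion_lt hf (n + 1)) =
            unitIndicatorLp p μ (measurableSet_iUnion_lt hf n) + unitIndicatorLp p μ (hf n) := by
          rw [← unitIndicatorLp_union _ _ hdis]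
          exact unitIndicatorLp_congr _ _ (Set.biUnion_lt_succ f n)
        rw [Finset.sum_range_succ, ih, this, map_add, ENNReal.ofReal_add (hΦ _ _) (hΦ _ _)]
    -- The partial sums converge to the series and, by continuity of Φ, to its value on the
    -- indicator of the union.
    refine tendsto_nhds_unique ?_ (ENNReal.tendsto_nat_tsum _)
    simp_rw [hsum]
    exact ENNReal.tendsto_ofReal ((Φ.continuous.tendsto _).comp
      (tendsto_unitIndicatorLp_iUnion hp hf hd))

theorem memLp_simpleFunc (f : SimpleFunc Z ℝ) : MemLp f p μ :=
  SimpleFunc.memLp_of_isFiniteMeasure f p μ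

/-- A measure coming from a functional of norm at most `K` integrates nonnegative functions with
the bound `K`. -/
theorem lintegral_le_of_functional [Fact (1 ≤ p)] (Φ : Lp ℝ p μ →L[ℝ] ℝ) {ν : Measure Z} {K : ℝ≥0}
    (hK : ‖Φ‖ ≤ K) (hΦ : ∀ s (hs : MeasurableSet s), 0 ≤ Φ (unitIndicatorLp p μ hs))
    (hν : ∀ s (hs : MeasurableSet s), ν s = ENNReal.ofReal (Φ (unitIndicatorLp p μ hs)))
    (Y : Z → ℝ≥0∞) : ∫⁻ z, Y z ∂ν ≤ K * eLpNorm Y p μ := by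
  have hmem : ∀ f : SimpleFunc Z ℝ≥0, MemLp (fun z => (f z : ℝ)) p μ := fun f =>
    memLp_simpleFunc (f.map fun a : ℝ≥0 => (a : ℝ))
  have key : ∀ f : SimpleFunc Z ℝ≥0,
      ∫⁻ z, (f z : ℝ≥0∞) ∂ν = ENNReal.ofReal (Φ ((hmem f).toLp _)) ∧ 0 ≤ Φ ((hmem f).toLp _) := by
    intro f
    induction f using SimpleFunc.induction with
    | const c hs =>
      rename_i s
      have h1 : (hmem (SimpleFunc.piecewise s hs (SimpleFunc.const Z c) (SimpleFunc.const Z 0))).toLp _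
          = (c : ℝ) • unitIndicatorLp p μ hs := by
        apply Lp.ext
        grw [MemLp.coeFn_toLp, Lp.coeFn_smul, unitIndicatorLp]
        filter_upwards [indicatorConstLp_coeFn (p := p) (hs := hs)
          (hμs := measure_ne_top μ s) (c := (1 : ℝ))] with z hz
        rw [Pi.smul_apply, hz]
        by_cases hzs : z ∈ s <;> simp [hzs]
      rw [h1, map_smul, smul_eq_mul]
      refine ⟨?_, mul_nonneg c.2 (hΦ s hs)⟩
      rw [ENNReal.ofReal_mul (NNReal.coe_nonneg c), ← hν s hs, ENNReal.ofReal_coe_nnreal]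
      have : ∀ z, ((SimpleFunc.piecewise s hs (SimpleFunc.const Z c) (SimpleFunc.const Z 0) z : ℝ≥0)
          : ℝ≥0∞) = s.indicator (fun _ => (c : ℝ≥0∞)) z := by
        intro z
        by_cases hzs : z ∈ s <;> simp [hzs]
      simp_rw [this]
      rw [lintegral_indicator_const hs]
    | add hd hf hg =>
      rename_i f g
      have h1 : (hmem (f + g)).toLp _ = (hmem f).toLp _ + (hmem g).toLp _ := by
        rw [← MemLp.toLp_add]
        congr 1
      rw [h1, map_add]
      refine ⟨?_, add_nonneg hf.2 hg.2⟩
      rw [ENNReal.ofReal_add hf.2 hg.2, ← hf.1, ← hg.1, ← lintegral_add_left]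
      · simp
      · exact f.measurable.coe_nnreal_ennreal
  -- The integral is a supremum over `ℝ≥0`-valued simple functions below Y, on which it coincides
  -- with Φ; Y itself need not be measurable.
  rw [lintegral_eq_nnreal]
  refine iSup₂_le fun f hf => ?_
  have h2 : (f.map ((↑) : ℝ≥0 → ℝ≥0∞)).lintegral ν = ∫⁻ z, (f z : ℝ≥0∞) ∂ν := by
    rw [← SimpleFunc.lintegral_eq_lintegral]
    rfl
  rw [h2, (key f).1]
  calc ENNReal.ofReal (Φ ((hmem f).toLp _)) ≤ ENNReal.ofReal (K * ‖(hmem f).toLp _‖) := by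
        refine ENNReal.ofReal_le_ofReal ((le_abs_self _).trans ?_)
        exact (Φ.le_opNorm _).trans (by gcongr)
    _ = K * eLpNorm (fun z => (f z : ℝ)) p μ := by
        rw [ENNReal.ofReal_mul (NNReal.coe_nonneg K), ENNReal.ofReal_coe_nnreal, Lp.norm_toLp,
          ENNReal.ofReal_toReal (hmem f).eLpNorm_ne_top]
    _ ≤ K * eLpNorm Y p μ := by
        gcongr
        refine eLpNorm_mono_enorm fun z => ?_
        simpa [← ofReal_norm] using hf z

/-- If `∫ Y dν ≤ K ‖Y‖_p` for all nonnegative `Y`, the density of `ν` lies in the ball of radius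
`K` of `L^q`. -/
theorem memLp_rnDeriv_of_lintegral_le (hp : p ≠ ∞) [ENNReal.HolderConjugate q p] {ν : Measure Z}
    [IsFiniteMeasure ν] (hac : ν ≪ μ) {K : ℝ≥0}
    (hK : ∀ Y : Z → ℝ≥0∞, ∫⁻ z, Y z ∂ν ≤ K * eLpNorm Y p μ) :
    MemLp (fun z => (ν.rnDeriv μ z).toReal) q μ := by
  have hmeas : Measurable (ν.rnDeriv μ) := Measure.measurable_rnDeriv ν μ
  have hm : AEStronglyMeasurable (fun z => (ν.rnDeriv μ z).toReal) μ :=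
    hmeas.ennreal_toReal.aestronglyMeasurable
  by_cases hq : q = ∞
  · subst hq
    have hp1 : p = 1 := (ENNReal.HolderConjugate.unique ∞ p 1)
    subst hp1
    -- Testing with indicators gives ν s ≤ K μ s, so the density is at most K.
    have hle : ν.rnDeriv μ ≤ᵐ[μ] fun _ => (K : ℝ≥0∞) := by
      refine ae_le_of_forall_setLIntegral_le_of_sigmaFinite hmeas fun s hs _ => ?_
      rw [Measure.setLIntegral_rnDeriv hac, setLIntegral_const]
      have h := hK (s.indicator fun _ => 1)
      rw [lintegral_indicator_const hs, one_mul, eLpNorm_one_eq_lintegral_enorm] at h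
      refine h.trans (le_of_eq ?_)
      congr 1
      have : ∀ z, ‖s.indicator (fun _ => (1 : ℝ≥0∞)) z‖ₑ = s.indicator (fun _ => 1) z := fun z => rfl
      simp_rw [this]
      rw [lintegral_indicator_const hs, one_mul]
    refine memLp_top_of_bound hm K ?_
    filter_upwards [hle] with z hz
    rw [Real.norm_of_nonneg ENNReal.toReal_nonneg]
    exact ENNReal.toReal_le_of_le_ofReal K.2 (by simpa using hz)
  · have hq1 : 1 ≤ q := ENNReal.HolderConjugate.one_le q p
    have hp0 : p ≠ 0 := ENNReal.HolderConjugate.ne_zero p q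
    have hq0 : q ≠ 0 := ENNReal.HolderConjugate.ne_zero q p
    have hpq : Real.HolderConjugate q.toReal p.toReal := by
      have hq1' : q ≠ 1 := by
        rintro rfl
        exact hp (ENNReal.HolderConjugate.unique 1 p ∞)
      exact ENNReal.HolderConjugate.toReal
        (by simpa using ENNReal.toReal_strict_mono hq (lt_of_le_of_ne hq1 hq1'.symm))
    have hqpos : 0 < q.toReal := hpq.pos
    set g := ν.rnDeriv μ with hg
    -- For q < ∞ the test function is the (q-1)-th power of the truncated density G. With I = ∫ G^q
    -- dμ one gets I ≤ ∫ G^(q-1) dν ≤ K I^(1/p), since (q-1)p = q. Hence I^(1/q) ≤ K, and monotone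
    -- convergence removes the truncation.
    let G : ℕ → Z → ℝ≥0∞ := fun m z => min (g z) m
    have hGm : ∀ m, Measurable (G m) := fun m => hmeas.min measurable_const
    have hbound : ∀ m, ∫⁻ z, G m z ^ q.toReal ∂μ ≤ (K : ℝ≥0∞) ^ q.toReal := by
      intro m
      have h1 : ∫⁻ z, G m z ^ q.toReal ∂μ ≤ ∫⁻ z, G m z ^ (q.toReal - 1) ∂ν := by
        rw [← lintegral_rnDeriv_mul hac ((hGm m).pow_const _).aemeasurable]
        refine lintegral_mono fun z => ?_
        calc G m z ^ q.toReal = G m z ^ (1 + (q.toReal - 1)) := by ring_nf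
          _ = G m z * G m z ^ (q.toReal - 1) := by
            rw [ENNReal.rpow_add_of_nonneg _ _ zero_le_one hpq.sub_one_pos.le, ENNReal.rpow_one]
          _ ≤ _ := by gcongr; exact min_le_left _ _
      have h2 := h1.trans (hK _)
      rw [eLpNorm_eq_lintegral_rpow_enorm_toReal hp0 hp] at h2
      have h3 : ∀ z, ‖G m z ^ (q.toReal - 1)‖ₑ ^ p.toReal = G m z ^ q.toReal := by
        intro z
        rw [enorm_eq_self, ← ENNReal.rpow_mul, hpq.sub_one_mul_conj]
      simp_rw [h3] at h2
      set I := ∫⁻ z, G m z ^ q.toReal ∂μ with hI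
      -- Only the truncation guarantees this; it allows cancelling I^(1/p) below.
      have hfin : I ≠ ∞ := by
        refine ne_top_of_le_ne_top (b := (m : ℝ≥0∞) ^ q.toReal)
          (ENNReal.rpow_ne_top_of_nonneg hqpos.le (by simp)) ?_
        calc I ≤ ∫⁻ _, (m : ℝ≥0∞) ^ q.toReal ∂μ := by
              refine lintegral_mono fun z => ?_
              gcongr
              exact min_le_right _ _
          _ = _ := by simp
      by_cases hI0 : I = 0
      · simp [hI0]
      have h4 : I ^ (1 / q.toReal) ≤ K := by
        have h5 : I ^ (1 / q.toReal) * I ^ (1 / p.toReal) ≤ K * I ^ (1 / p.toReal) := by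
          rw [← ENNReal.rpow_add _ _ hI0 hfin, one_div, one_div, hpq.inv_add_inv_eq_one,
            ENNReal.rpow_one]
          simpa using h2
        exact (ENNReal.mul_le_mul_iff_left (by simp [hI0, hfin])
          (ENNReal.rpow_ne_top_of_nonneg (by positivity) hfin)).1 h5
      calc I = (I ^ (1 / q.toReal)) ^ q.toReal := by
            rw [← ENNReal.rpow_mul, one_div_mul_cancel hqpos.ne', ENNReal.rpow_one]
        _ ≤ _ := by gcongr
    have hint : ∫⁻ z, g z ^ q.toReal ∂μ ≤ (K : ℝ≥0∞) ^ q.toReal := by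
      have hlim : ∀ z, g z ^ q.toReal = ⨆ m, G m z ^ q.toReal := by
        intro z
        have h := (ENNReal.orderIsoRpow q.toReal hqpos).map_iSup fun m : ℕ => min (g z) (m : ℝ≥0∞)
        simp only [ENNReal.orderIsoRpow_apply] at h
        rw [← h]
        have h2 : ⨆ m : ℕ, min (g z) (m : ℝ≥0∞) = g z := by
          rw [← inf_iSup_eq, ENNReal.iSup_natCast, inf_top_eq]
        rw [h2]
      simp_rw [hlim]
      rw [lintegral_iSup (fun m => (hGm m).pow_const _)]
      · exact iSup_le hbound
      · intro m k hmk z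
        simp only [G]
        gcongr
    refine ⟨hm, ?_⟩
    rw [eLpNorm_lt_top_iff_lintegral_rpow_enorm_lt_top hq0 hq]
    refine lt_of_le_of_lt (lintegral_mono fun z => ?_)
      (hint.trans_lt (ENNReal.rpow_lt_top_of_nonneg hqpos.le (by simp)))
    gcongr
    rw [← ofReal_norm, Real.norm_of_nonneg ENNReal.toReal_nonneg]
    exact ENNReal.ofReal_toReal_le

/-- A positive functional on `L^p`, `p < ∞`, is represented by an element of `L^q`. -/
theorem exists_Lp_of_nonneg_functional [Fact (1 ≤ p)] [Fact (1 ≤ q)] (hp : p ≠ ∞)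
    [ENNReal.HolderConjugate q p]
    (Φ : Lp ℝ p μ →L[ℝ] ℝ) (hΦ : ∀ s (hs : MeasurableSet s), 0 ≤ Φ (unitIndicatorLp p μ hs)) :
    ∃ g : Lp ℝ q μ, ∀ Y : Lp ℝ p μ, Φ Y = ∫ z, g z * Y z ∂μ := by
  obtain ⟨ν, hν⟩ := exists_measure_of_nonneg_functional hp Φ hΦ
  have hfin : IsFiniteMeasure ν := ⟨by rw [hν _ MeasurableSet.univ]; exact ENNReal.ofReal_lt_top⟩
  have hle := lintegral_le_of_functional Φ (K := ‖Φ‖₊) le_rfl hΦ hν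
  have hac : ν ≪ μ := by
    refine Measure.AbsolutelyContinuous.mk fun s hs hs0 => ?_
    have : unitIndicatorLp p μ hs = 0 := by
      apply Lp.ext
      grw [unitIndicatorLp, indicatorConstLp_coeFn, Lp.coeFn_zero]
      filter_upwards [measure_eq_zero_iff_ae_notMem.1 hs0] with z hz
      simp [hz]
    rw [hν s hs, this]
    simp
  have hmem := memLp_rnDeriv_of_lintegral_le (q := q) hp hac hle
  refine ⟨hmem.toLp, ?_⟩
  let B : Lp ℝ p μ →L[ℝ] ℝ := (ContinuousLinearMap.mul ℝ ℝ).lpPairing μ q p hmem.toLp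
  have hB : ∀ Y : Lp ℝ p μ, B Y = ∫ z, (hmem.toLp : Lp ℝ q μ) z * Y z ∂μ := fun Y =>
    ContinuousLinearMap.lpPairing_eq_integral _ _ _
  -- Two continuous functionals agree once they agree on indicators, by density of simple functions
  -- in L^p for p < ∞.
  suffices h : ∀ Y, Φ Y = B Y from fun Y => (h Y).trans (hB Y)
  refine Lp.induction hp _ ?_ ?_ (isClosed_eq Φ.continuous B.continuous)
  · intro c s hs hμs
    have h1 : (Lp.simpleFunc.indicatorConst p hs hμs.ne c : Lp ℝ p μ) =
        c • unitIndicatorLp p μ hs := by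
      rw [Lp.simpleFunc.coe_indicatorConst]
      apply Lp.ext
      grw [Lp.coeFn_smul, unitIndicatorLp, indicatorConstLp_coeFn]
      filter_upwards [indicatorConstLp_coeFn (p := p) (hs := hs)
          (hμs := measure_ne_top μ s) (c := (1 : ℝ))] with z hz
      rw [Pi.smul_apply, hz]
      by_cases hzs : z ∈ s <;> simp [hzs]
    rw [h1, map_smul, map_smul]
    congr 1
    rw [hB]
    have h2 : ∫ z, (hmem.toLp : Lp ℝ q μ) z * unitIndicatorLp p μ hs z ∂μ =
        ∫ z in s, (ν.rnDeriv μ z).toReal ∂μ := by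
      rw [← integral_indicator hs]
      refine integral_congr_ae ?_
      filter_upwards [hmem.coeFn_toLp, indicatorConstLp_coeFn (p := p) (hs := hs)
          (hμs := measure_ne_top μ s) (c := (1 : ℝ))] with z hz1 hz2
      rw [hz1, unitIndicatorLp, hz2]
      by_cases hzs : z ∈ s <;> simp [hzs]
    rw [h2, Measure.setIntegral_toReal_rnDeriv hac, measureReal_def, hν s hs,
      ENNReal.toReal_ofReal (hΦ s hs)]
  · intro f g hf hg _ h1 h2
    rw [map_add, map_add, h1, h2]

end PositiveFunctional

theorem conjExponent_ne_top {q : ℝ≥0∞} (hq : 1 < q) : q.conjExponent ≠ ∞ := by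
  rw [ENNReal.conjExponent]
  exact ENNReal.add_ne_top.2 ⟨ENNReal.one_ne_top, ENNReal.inv_ne_top.2 (tsub_pos_of_lt hq).ne'⟩

/-! ### Weak* topology and weak* compactness of sets of densities -/

namespace DensityMeasure

variable {Z : Type*} [MeasurableSpace Z] {q : ℝ≥0∞} {μ : Measure Z}

/-- The expectation of `Y ∈ L^p(μ)` under `Q ∈ ℳ^q(Z, μ)`. -/
noncomputable def pairing (Q : DensityMeasure q μ) (Y : Lp ℝ q.conjExponent μ) : ℝ :=
  ∫ z, Q.density z * Y z ∂μ

theorem continuous_pairing_left (Y : Lp ℝ q.conjExponent μ) :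
    Continuous fun Q : DensityMeasure q μ => Q.pairing Y := by
  have h1 : Continuous[weakStarTopology q μ, inferInstance]
      (fun (g : Lp ℝ q μ) (Y : Lp ℝ q.conjExponent μ) => ∫ z, g z * Y z ∂μ) :=
    continuous_induced_dom
  have h2 : Continuous[inferInstance, weakStarTopology q μ]
      (density : DensityMeasure q μ → Lp ℝ q μ) := continuous_induced_dom
  exact (continuous_apply Y).comp (@Continuous.comp _ _ _ _ (weakStarTopology q μ) _ _ _ h1 h2)

/-- The weak* trace is thus pointwise convergence on L^p, so compactness can be tested in a product
of real lines. -/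
theorem isInducing_pairing :
    IsInducing (pairing : DensityMeasure q μ → Lp ℝ q.conjExponent μ → ℝ) := by
  refine ⟨?_⟩
  change TopologicalSpace.induced density (weakStarTopology q μ) = _
  rw [weakStarTopology, induced_compose]
  rfl

section

variable [Fact (1 ≤ q)]

instance : Fact (1 ≤ q.conjExponent) := ⟨ENNReal.HolderConjugate.one_le _ q⟩

/-- The expectation under `Q` as a continuous linear functional on `L^p(μ)`. -/
noncomputable def pairingCLM (Q : DensityMeasure q μ) : Lp ℝ q.conjExponent μ →L[ℝ] ℝ :=
  (ContinuousLinearMap.mul ℝ ℝ).lpPairing μ q q.conjExponent Q.density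

theorem pairingCLM_apply (Q : DensityMeasure q μ) (Y : Lp ℝ q.conjExponent μ) :
    Q.pairingCLM Y = Q.pairing Y :=
  ContinuousLinearMap.lpPairing_eq_integral _ _ _

theorem continuous_pairing_right (Q : DensityMeasure q μ) : Continuous Q.pairing :=
  (continuous_congr Q.pairingCLM_apply).1 Q.pairingCLM.continuous

theorem pairing_sub (Q : DensityMeasure q μ) (Y Y' : Lp ℝ q.conjExponent μ) :
    Q.pairing (Y - Y') = Q.pairing Y - Q.pairing Y' := by
  simp only [← pairingCLM_apply, map_sub]

/-- Hölder's inequality. It provides the compact box for Tychonoff's theorem and the common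
Lipschitz constant for almost maximizers. -/
theorem abs_pairing_le (Q : DensityMeasure q μ) {K : ℝ≥0} (hQ : eLpNorm Q.density q μ ≤ K)
    (Y : Lp ℝ q.conjExponent μ) : |Q.pairing Y| ≤ K * ‖Y‖ := by
  have h1 : ‖Q.pairing Y‖ₑ ≤ K * ‖Y‖ₑ := by
    calc ‖Q.pairing Y‖ₑ ≤ ∫⁻ z, ‖Q.density z * Y z‖ₑ ∂μ := enorm_integral_le_lintegral_enorm _
      _ = eLpNorm (⇑Q.density • ⇑Y) 1 μ := by rw [eLpNorm_one_eq_lintegral_enorm]; rfl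
      _ ≤ eLpNorm Q.density q μ * eLpNorm Y q.conjExponent μ :=
        eLpNorm_smul_le_mul_eLpNorm (Lp.aestronglyMeasurable _) (Lp.aestronglyMeasurable _)
      _ ≤ K * ‖Y‖ₑ := by rw [Lp.enorm_def]; gcongr
  rw [← Real.norm_eq_abs, ← ENNReal.ofReal_le_ofReal_iff (by positivity),
    ENNReal.ofReal_mul (NNReal.coe_nonneg K), ENNReal.ofReal_coe_nnreal, ofReal_norm, ofReal_norm]
  exact h1

end

variable [IsProbabilityMeasure μ]

theorem pairing_eq_integral (Q : DensityMeasure q μ) (Y : Lp ℝ q.conjExponent μ) :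
    Q.pairing Y = ∫ z, Y z ∂Q.toMeasure := by
  rw [← integral_toReal_rnDeriv_mul Q.ac]
  refine integral_congr_ae ?_
  filter_upwards [Q.memLp.coeFn_toLp] with z hz
  have : Q.density z = _ := hz
  rw [this]

theorem pairing_toLp (Q : DensityMeasure q μ) {Y : Z → ℝ} (hY : MemLp Y q.conjExponent μ) :
    Q.pairing hY.toLp = ∫ z, Y z ∂Q.toMeasure := by
  rw [pairing_eq_integral]
  exact integral_congr_ae (Q.ac.ae_eq hY.coeFn_toLp)

theorem pairing_unitIndicatorLp (Q : DensityMeasure q μ) {s : Set Z} (hs : MeasurableSet s) :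
    Q.pairing (unitIndicatorLp q.conjExponent μ hs) = Q.toMeasure.real s := by
  rw [pairing_eq_integral, ← integral_indicator_one hs]
  refine integral_congr_ae (Q.ac.ae_eq ?_)
  grw [unitIndicatorLp, indicatorConstLp_coeFn]
  rfl

/-- Indicators belong to L^p and recover the measure; the remaining fields are propositions. -/
theorem ext_of_pairing {Q Q' : DensityMeasure q μ} (h : ∀ Y, Q.pairing Y = Q'.pairing Y) :
    Q = Q' := by
  have h1 : Q.toMeasure = Q'.toMeasure := by
    ext s hs
    have := h (unitIndicatorLp _ μ hs)
    rw [pairing_unitIndicatorLp, pairing_unitIndicatorLp, measureReal_def, measureReal_def] at this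
    exact (ENNReal.toReal_eq_toReal_iff' (measure_ne_top _ _) (measure_ne_top _ _)).1 this
  cases Q
  cases Q'
  simp only at h1
  subst h1
  rfl

variable [Fact (1 ≤ q)]

theorem integrable_of_memLp (Q : DensityMeasure q μ) {Y : Z → ℝ} (hY : MemLp Y q.conjExponent μ) :
    Integrable Y Q.toMeasure :=
  (integrable_toReal_rnDeriv_mul_iff Q.ac).1 (Q.memLp.integrable_mul hY)

/-- A norm bounded set of densities that is weak* closed in `L^q` is weak* compact. -/
theorem compactSpace_of_isClosed (hq : 1 < q) {𝒮 : Set (DensityMeasure q μ)} {K : ℝ≥0}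
    (hK : ∀ Q ∈ 𝒮, eLpNorm Q.density q μ ≤ K)
    (hcl : IsClosed[weakStarTopology q μ] (density '' 𝒮)) : CompactSpace 𝒮 := by
  have hp : q.conjExponent ≠ ∞ := conjExponent_ne_top hq
  rw [isClosed_induced_iff] at hcl
  obtain ⟨t, ht, hts⟩ := hcl
  rw [← isCompact_iff_compactSpace, isInducing_pairing.isCompact_iff]
  let box : Set (Lp ℝ q.conjExponent μ → ℝ) := Set.univ.pi fun Y => Set.Icc (-(K * ‖Y‖)) (K * ‖Y‖)
  have hbox : IsCompact box := isCompact_univ_pi fun Y => isCompact_Icc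
  -- Linearity and nonnegativity on indicators are closed conditions on coordinates. The box bounds
  -- such functionals by K, so they have densities in L^q.
  let C : Set (Lp ℝ q.conjExponent μ → ℝ) :=
    {Φ | (∀ Y Y', Φ (Y + Y') = Φ Y + Φ Y') ∧ (∀ (c : ℝ) Y, Φ (c • Y) = c * Φ Y) ∧
      ∀ s (hs : MeasurableSet s), 0 ≤ Φ (unitIndicatorLp _ μ hs)}
  have hC : IsClosed C := by
    have hCeq : C = (⋂ Y, ⋂ Y', {Φ | Φ (Y + Y') = Φ Y + Φ Y'}) ∩
        ((⋂ c : ℝ, ⋂ Y, {Φ | Φ (c • Y) = c * Φ Y}) ∩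
          ⋂ s, ⋂ hs : MeasurableSet s, {Φ | 0 ≤ Φ (unitIndicatorLp _ μ hs)}) := by
      ext Φ
      simp [C]
    rw [hCeq]
    refine IsClosed.inter ?_ (IsClosed.inter ?_ ?_)
    · exact isClosed_iInter fun Y => isClosed_iInter fun Y' =>
        isClosed_eq (continuous_apply _) ((continuous_apply Y).add (continuous_apply Y'))
    · exact isClosed_iInter fun c => isClosed_iInter fun Y =>
        isClosed_eq (continuous_apply _) (continuous_const.mul (continuous_apply Y))
    · exact isClosed_iInter fun s => isClosed_iInter fun hs =>
        isClosed_le continuous_const (continuous_apply _)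
  have himage : pairing '' 𝒮 = box ∩ (C ∩ t) := by
    apply Set.Subset.antisymm
    · rintro _ ⟨Q, hQ, rfl⟩
      refine ⟨fun Y _ => abs_le.1 (Q.abs_pairing_le (hK Q hQ) Y), ⟨?_, ?_, ?_⟩, ?_⟩
      · intro Y Y'
        simp only [← pairingCLM_apply, map_add]
      · intro c Y
        simp only [← pairingCLM_apply, map_smul, smul_eq_mul]
      · intro s hs
        rw [pairing_unitIndicatorLp]
        exact measureReal_nonneg
      · have : Q.density ∈ density '' 𝒮 := ⟨Q, hQ, rfl⟩
        rw [← hts] at this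
        exact this
    · rintro Φ ⟨hb, ⟨hadd, hsmul, hpos⟩, hΦt⟩
      let Ψ : Lp ℝ q.conjExponent μ →L[ℝ] ℝ :=
        LinearMap.mkContinuous ⟨⟨Φ, hadd⟩, hsmul⟩ K fun Y => abs_le.2 (hb Y trivial)
      obtain ⟨g, hg⟩ := exists_Lp_of_nonneg_functional (q := q) hp Ψ hpos
      have hΦg : Φ = fun Y => ∫ z, g z * Y z ∂μ := funext hg
      -- The closed set t pulls back to the densities of 𝒮. So g automatically belongs to a
      -- probability measure in 𝒮, and total mass one needs no separate condition.
      have hmem : g ∈ density '' 𝒮 := by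
        rw [← hts]
        change (fun Y : Lp ℝ q.conjExponent μ => ∫ z, g z * Y z ∂μ) ∈ t
        rwa [← hΦg]
      obtain ⟨Q, hQ, rfl⟩ := hmem
      exact ⟨Q, hQ, hΦg.symm⟩
  rw [himage]
  exact hbox.inter_right (hC.inter ht)

end DensityMeasure

/-! ### Measurable selection of maximizers and almost maximizers -/

section Selection

variable {X K : Type*} [MeasurableSpace X]

/-- The maximizers of `f` over `F`. -/
def argmaxSet (F : Set K) (f : K → ℝ) : Set K := {Q | Q ∈ F ∧ ∀ Q' ∈ F, f Q' ≤ f Q}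

theorem isClosed_argmaxSet [TopologicalSpace K] {F : Set K} {f : K → ℝ} (hF : IsClosed F)
    (hf : Continuous f) : IsClosed (argmaxSet F f) := by
  have : argmaxSet F f = F ∩ ⋂ Q' ∈ F, {Q | f Q' ≤ f Q} := by
    ext Q
    simp [argmaxSet]
  rw [this]
  exact hF.inter (isClosed_biInter fun Q' _ => isClosed_le continuous_const hf)

theorem argmaxSet_nonempty [TopologicalSpace K] [CompactSpace K] {F : Set K} {f : K → ℝ}
    (hF : IsClosed F) (hne : F.Nonempty) (hf : Continuous f) : (argmaxSet F f).Nonempty := by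
  obtain ⟨Q, hQ, hmax⟩ := hF.isCompact.exists_isMaxOn hne hf.continuousOn
  exact ⟨Q, hQ, fun Q' hQ' => hmax hQ'⟩

/-- Lexicographic maximization: first `h`, then `g 0`, `g 1`, …. -/
def lexArgmax (h : K → ℝ) (g : ℕ → K → ℝ) : ℕ → Set K
  | 0 => argmaxSet Set.univ h
  | k + 1 => argmaxSet (lexArgmax h g k) (g k)

variable [TopologicalSpace K]

theorem isClosed_lexArgmax {h : K → ℝ} {g : ℕ → K → ℝ} (hh : Continuous h)
    (hg : ∀ k, Continuous (g k)) : ∀ k, IsClosed (lexArgmax h g k)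
  | 0 => isClosed_argmaxSet isClosed_univ hh
  | k + 1 => isClosed_argmaxSet (isClosed_lexArgmax hh hg k) (hg k)

variable [CompactSpace K]

theorem lexArgmax_nonempty [Nonempty K] {h : K → ℝ} {g : ℕ → K → ℝ} (hh : Continuous h)
    (hg : ∀ k, Continuous (g k)) : ∀ k, (lexArgmax h g k).Nonempty
  | 0 => argmaxSet_nonempty isClosed_univ Set.univ_nonempty hh
  | k + 1 => argmaxSet_nonempty (isClosed_lexArgmax hh hg k) (lexArgmax_nonempty hh hg k) (hg k)

/-- Induction on the number of criteria. Meeting a closed set C is expressed at level 0 by comparing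
two suprema, and later by countably many instances of the previous level. -/
theorem measurableSet_lexArgmax_inter_nonempty [Nonempty K] {h : X → K → ℝ} {g : ℕ → K → ℝ}
    (hh : ∀ x, Continuous (h x)) (hg : ∀ k, Continuous (g k))
    (hm : ∀ C : Set K, IsClosed C → C.Nonempty → Measurable fun x => ⨆ Q : C, h x Q) (k : ℕ) :
    ∀ C : Set K, IsClosed C → MeasurableSet {x | (lexArgmax (h x) g k ∩ C).Nonempty} := by
  induction k with
  | zero =>
    intro C hC
    rcases C.eq_empty_or_nonempty with rfl | hne
    · simp
    have hbdd : ∀ x (D : Set K), BddAbove (Set.range fun Q : D => h x Q) := fun x D =>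
      (isCompact_range (hh x)).bddAbove.mono (Set.range_comp_subset_range _ _)
    have : {x | (lexArgmax (h x) g 0 ∩ C).Nonempty} =
        {x | ⨆ Q : (Set.univ : Set K), h x Q ≤ ⨆ Q : C, h x Q} := by
      ext x
      constructor
      · rintro ⟨Q, hQ, hQC⟩
        have : Nonempty (Set.univ : Set K) := ⟨⟨Q, trivial⟩⟩
        exact ciSup_le fun Q' => (hQ.2 _ trivial).trans (le_ciSup (hbdd x C) ⟨Q, hQC⟩)
      · intro hx
        obtain ⟨Q, hQ, hmax⟩ := hC.isCompact.exists_isMaxOn hne (hh x).continuousOn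
        have : Nonempty C := ⟨⟨Q, hQ⟩⟩
        refine ⟨Q, ⟨trivial, fun Q' _ => ?_⟩, hQ⟩
        exact (le_ciSup (hbdd x _) (⟨Q', trivial⟩ : (Set.univ : Set K))).trans (hx.trans (ciSup_le fun Q'' => hmax Q''.2))
    rw [this]
    exact measurableSet_le (hm _ isClosed_univ (hne.mono (Set.subset_univ _))) (hm C hC hne)
  | succ k ih =>
    intro C hC
    have hlev : ∀ c : ℝ, IsClosed {Q | c ≤ g k Q} := fun c => isClosed_le continuous_const (hg k)
    -- The maximum of `g k` over the previous level is attained in C exactly when every rational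
    -- threshold reached on that level is also reached inside C.
    have : {x | (lexArgmax (h x) g (k + 1) ∩ C).Nonempty} =
        {x | ∀ c : ℚ, (lexArgmax (h x) g k ∩ {Q | (c : ℝ) ≤ g k Q}).Nonempty →
          (lexArgmax (h x) g k ∩ (C ∩ {Q | (c : ℝ) ≤ g k Q})).Nonempty} := by
      ext x
      constructor
      · rintro ⟨Q, hQ, hQC⟩ c ⟨Q', hQ', hc⟩
        exact ⟨Q, hQ.1, hQC, le_trans hc (hQ.2 Q' hQ')⟩
      · intro hx
        have hne := lexArgmax_nonempty (hh x) hg k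
        have hcl := isClosed_lexArgmax (hh x) hg k
        obtain ⟨Q₀, hQ₀, hmax₀⟩ := argmaxSet_nonempty hcl hne (hg k)
        have hneC : (lexArgmax (h x) g k ∩ C).Nonempty := by
          obtain ⟨c, hc⟩ := exists_rat_lt (g k Q₀)
          obtain ⟨Q, h1, h2, -⟩ := hx c ⟨Q₀, hQ₀, hc.le⟩
          exact ⟨Q, h1, h2⟩
        obtain ⟨Q, hQ, hmax⟩ := argmaxSet_nonempty (hcl.inter hC) hneC (hg k)
        refine ⟨Q, ⟨hQ.1, fun Q' hQ' => (hmax₀ Q' hQ').trans ?_⟩, hQ.2⟩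
        by_contra! hlt
        obtain ⟨c, hc1, hc2⟩ := exists_rat_btwn hlt
        obtain ⟨Q'', h1, h2, h3⟩ := hx c ⟨Q₀, hQ₀, hc2.le⟩
        exact absurd (hmax Q'' ⟨h1, h2⟩) (not_le.2 (lt_of_lt_of_le hc1 h3))
    rw [this, Set.ofPred_forall]
    refine MeasurableSet.iInter fun c => ?_
    exact (ih _ (hlev c)).himp (ih _ (hC.inter (hlev c)))

/-- A measurable selection of maximizers over a compact space on which countably many continuous
functions separate points. -/
theorem exists_measurable_argmax [Nonempty K] [MeasurableSpace K] [BorelSpace K] {h : X → K → ℝ}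
    {g : ℕ → K → ℝ} (hh : ∀ x, Continuous (h x)) (hg : ∀ k, Continuous (g k))
    (hm : ∀ C : Set K, IsClosed C → C.Nonempty → Measurable fun x => ⨆ Q : C, h x Q)
    (hsep : ∀ Q Q', (∀ k, g k Q = g k Q') → Q = Q') :
    ∃ S : X → K, Measurable S ∧ ∀ x Q, h x Q ≤ h x (S x) := by
  have hcl := fun x => isClosed_lexArgmax (hh x) hg
  have hanti : ∀ x k, lexArgmax (h x) g (k + 1) ⊆ lexArgmax (h x) g k := fun x k Q hQ => hQ.1
  have hne : ∀ x, (⋂ k, lexArgmax (h x) g k).Nonempty := fun x =>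
    IsCompact.nonempty_iInter_of_sequence_nonempty_isCompact_isClosed _ (hanti x)
      (lexArgmax_nonempty (hh x) hg) (hcl x 0).isCompact (hcl x)
  choose S hS using hne
  simp only [Set.mem_iInter] at hS
  -- Two points surviving all levels give the same value to every `g k`, hence coincide.
  have huniq : ∀ x Q, (∀ k, Q ∈ lexArgmax (h x) g k) → Q = S x := fun x Q hQ =>
    hsep _ _ fun k => le_antisymm ((hS x (k + 1)).2 Q (hQ k)) ((hQ (k + 1)).2 _ (hS x k))
  refine ⟨S, measurable_of_isClosed fun C hC => ?_, fun x Q => (hS x 0).2 Q trivial⟩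
  -- For the reverse inclusion, the decreasing compact sets meeting C have a common point in C,
  -- which by uniqueness is S x.
  have : S ⁻¹' C = ⋂ k, {x | (lexArgmax (h x) g k ∩ C).Nonempty} := by
    ext x
    simp only [Set.mem_preimage, Set.mem_iInter]
    constructor
    · exact fun hx k => ⟨S x, hS x k, hx⟩
    · intro hx
      obtain ⟨Q, hQ⟩ := IsCompact.nonempty_iInter_of_sequence_nonempty_isCompact_isClosed
        (fun k => lexArgmax (h x) g k ∩ C) (fun k => Set.inter_subset_inter_left _ (hanti x k))
        hx ((hcl x 0).inter hC).isCompact fun k => (hcl x k).inter hC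
      simp only [Set.mem_iInter, Set.mem_inter_iff] at hQ
      rw [← huniq x Q fun k => (hQ k).1]
      exact (hQ 0).2
  rw [this]
  exact MeasurableSet.iInter fun k => measurableSet_lexArgmax_inter_nonempty hh hg hm k C hC

end Selection

/-- A countably valued measurable selection of almost-maximizers of an equi-Lipschitz family of
functions on a separable metric space. -/
theorem exists_measurable_almost_argmax {Y K : Type*} [PseudoMetricSpace Y]
    [SecondCountableTopology Y] [MeasurableSpace Y] [OpensMeasurableSpace Y] [MeasurableSpace K]
    [Nonempty K] {h : Y → K → ℝ} {L : ℝ} (hL : 0 ≤ L)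
    (hlip : ∀ y y' k, |h y k - h y' k| ≤ L * dist y y')
    (hbdd : ∀ y, BddAbove (Set.range (h y))) {ε : ℝ} (hε : 0 < ε) :
    ∃ S : Y → K, Measurable S ∧ ∀ y k, h y k - ε ≤ h y (S y) := by
  classical
  rcases isEmpty_or_nonempty Y with hY | hY
  · exact ⟨fun _ => Classical.arbitrary K, measurable_const, fun y => hY.elim y⟩
  have hs : ∀ n, ∃ k, (⨆ k, h (TopologicalSpace.denseSeq Y n) k) - ε / 3 <
      h (TopologicalSpace.denseSeq Y n) k := fun n => exists_lt_of_lt_ciSup (by linarith)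
  choose s hs using hs
  -- The error splits into ε/3 for the choice at the dense point and ε/3 for each of two Lipschitz
  -- comparisons. L + 1 avoids dividing by zero.
  set δ := ε / (3 * (L + 1)) with hδ
  have hδ0 : 0 < δ := by positivity
  have hLδ : L * δ ≤ ε / 3 := by
    rw [hδ, ← mul_div_assoc, div_le_div_iff₀ (by positivity) (by positivity)]
    nlinarith
  have hex : ∀ y, ∃ n, dist y (TopologicalSpace.denseSeq Y n) < δ := fun y =>
    (TopologicalSpace.denseRange_denseSeq Y).exists_dist_lt y hδ0
  -- The selector factors through ℕ, hence is measurable for any σ-algebra on K.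
  refine ⟨fun y => s (Nat.find (hex y)), (measurable_from_top (f := s)).comp
    (measurable_find hex fun n => Metric.isOpen_ball.measurableSet), fun y k => ?_⟩
  have h1 := Nat.find_spec (hex y)
  set n := Nat.find (hex y)
  have h2 := hs n
  have h3 := le_ciSup (hbdd (TopologicalSpace.denseSeq Y n)) k
  have h4 := hlip y (TopologicalSpace.denseSeq Y n) k
  have h5 := hlip y (TopologicalSpace.denseSeq Y n) (s n)
  have h6 : L * dist y (TopologicalSpace.denseSeq Y n) ≤ ε / 3 :=
    (mul_le_mul_of_nonneg_left h1.le hL).trans hLδ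
  rw [abs_le] at h4 h5
  linarith [h4.1, h4.2, h5.1, h5.2]

/-! ### Worst-case measures as measurable functions of the integrand -/

namespace DensityMeasure

variable {Z : Type*} [MeasurableSpace Z] {q : ℝ≥0∞} {μ : Measure Z} [Fact (1 ≤ q)]
  {𝒮 : Set (DensityMeasure q μ)} {K : ℝ≥0}

theorem bddAbove_pairing (hK : ∀ Q ∈ 𝒮, eLpNorm Q.density q μ ≤ K)
    (Y : Lp ℝ q.conjExponent μ) : BddAbove (Set.range fun Q : 𝒮 => Q.1.pairing Y) := by
  refine ⟨K * ‖Y‖, ?_⟩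
  rintro _ ⟨Q, rfl⟩
  exact (le_abs_self _).trans (Q.1.abs_pairing_le (hK Q Q.2) Y)

/-- The worst-case expectation is a measurable functional on `L^p(μ)`. -/
theorem measurable_iSup_pairing [MeasurableSpace (Lp ℝ q.conjExponent μ)]
    [BorelSpace (Lp ℝ q.conjExponent μ)] (hK : ∀ Q ∈ 𝒮, eLpNorm Q.density q μ ≤ K) :
    Measurable fun Y => ⨆ Q : 𝒮, Q.1.pairing Y :=
  (lowerSemicontinuous_ciSup (bddAbove_pairing hK) fun Q : 𝒮 =>
    Q.1.continuous_pairing_right.lowerSemicontinuous).measurable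

variable [IsSeparable μ]

/-- Worst-case measures can be chosen measurably up to an error `ε > 0`. -/
theorem exists_measurable_almost_worst [MeasurableSpace (Lp ℝ q.conjExponent μ)]
    [BorelSpace (Lp ℝ q.conjExponent μ)] (hq : 1 < q) (hne : 𝒮.Nonempty)
    (hK : ∀ Q ∈ 𝒮, eLpNorm Q.density q μ ≤ K) {ε : ℝ} (hε : 0 < ε) :
    ∃ S : Lp ℝ q.conjExponent μ → 𝒮, Measurable S ∧
      ∀ Y, ∀ Q : 𝒮, Q.1.pairing Y - ε ≤ (S Y).1.pairing Y := by
  -- With separability of μ, the finite exponent gives separability of L^p through type class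
  -- inference.
  have : Fact (q.conjExponent ≠ ∞) := ⟨conjExponent_ne_top hq⟩
  have : Nonempty 𝒮 := hne.to_subtype
  refine exists_measurable_almost_argmax (h := fun Y (Q : 𝒮) => Q.1.pairing Y) K.2
    (fun Y Y' Q => ?_) (bddAbove_pairing hK) hε
  rw [← pairing_sub, dist_eq_norm]
  exact Q.1.abs_pairing_le (hK Q Q.2) _

/-- Worst-case measures can be chosen measurably from a weak* closed, bounded set. -/
theorem exists_measurable_worst [IsProbabilityMeasure μ] [MeasurableSpace (Lp ℝ q.conjExponent μ)]
    [BorelSpace (Lp ℝ q.conjExponent μ)] (hq : 1 < q) (hne : 𝒮.Nonempty)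
    (hK : ∀ Q ∈ 𝒮, eLpNorm Q.density q μ ≤ K)
    (hcl : IsClosed[weakStarTopology q μ] (density '' 𝒮)) :
    ∃ S : Lp ℝ q.conjExponent μ → 𝒮, Measurable S ∧
      ∀ Y, ∀ Q : 𝒮, Q.1.pairing Y ≤ (S Y).1.pairing Y := by
  have : Fact (q.conjExponent ≠ ∞) := ⟨conjExponent_ne_top hq⟩
  have : Nonempty 𝒮 := hne.to_subtype
  have : CompactSpace 𝒮 := compactSpace_of_isClosed hq hK hcl
  refine exists_measurable_argmax (h := fun Y (Q : 𝒮) => Q.1.pairing Y)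
    (g := fun k (Q : 𝒮) => Q.1.pairing (TopologicalSpace.denseSeq _ k))
    (fun Y => (continuous_pairing_left Y).comp continuous_subtype_val)
    (fun k => (continuous_pairing_left _).comp continuous_subtype_val) (fun C _ _ => ?_) ?_
  · refine (lowerSemicontinuous_ciSup (fun Y => ?_) fun Q : C =>
      Q.1.1.continuous_pairing_right.lowerSemicontinuous).measurable
    exact (bddAbove_pairing hK Y).mono
      (Set.range_comp_subset_range (fun Q : C => Q.1) fun Q : 𝒮 => Q.1.pairing Y)
  · intro Q Q' h
    refine Subtype.ext (ext_of_pairing fun Y => ?_)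
    exact congrFun ((TopologicalSpace.denseRange_denseSeq _).equalizer
      Q.1.continuous_pairing_right Q'.1.continuous_pairing_right (funext h)) Y

end DensityMeasure

/-- A jointly measurable function with sections in `L^p`, as a measurable map into `L^p`. -/
theorem measurable_toLp {X Z : Type*} [MeasurableSpace X] [MeasurableSpace Z] {μ : Measure Z}
    [IsProbabilityMeasure μ] [IsSeparable μ] {p : ℝ≥0∞} [Fact (1 ≤ p)] (hp : p ≠ ∞)
    [MeasurableSpace (Lp ℝ p μ)] [BorelSpace (Lp ℝ p μ)] {F : X → Z → ℝ}
    (hF : Measurable (Function.uncurry F)) (hmem : ∀ x, MemLp (F x) p μ) :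
    Measurable fun x => (hmem x).toLp := by
  have : Fact (p ≠ ∞) := ⟨hp⟩
  have hp0 : p ≠ 0 := (zero_lt_one.trans_le Fact.out).ne'
  -- Distances to a fixed g are measurable by Tonelli; in the separable space L^p every open set is
  -- a countable union of balls.
  have hdist : ∀ g : Lp ℝ p μ, Measurable fun x => edist ((hmem x).toLp) g := by
    intro g
    have h1 : ∀ x, edist ((hmem x).toLp) g =
        (∫⁻ z, ‖F x z - g z‖ₑ ^ p.toReal ∂μ) ^ (1 / p.toReal) := by
      intro x
      rw [Lp.edist_def, ← eLpNorm_eq_lintegral_rpow_enorm_toReal hp0 hp]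
      refine eLpNorm_congr_ae ?_
      filter_upwards [(hmem x).coeFn_toLp] with z hz
      simp [hz]
    simp_rw [h1]
    refine Measurable.pow_const (Measurable.lintegral_prod_right' (f := fun y : X × Z =>
      ‖F y.1 y.2 - g y.2‖ₑ ^ p.toReal) ?_) _
    exact ((hF.sub ((Lp.stronglyMeasurable g).measurable.comp measurable_snd)).enorm).pow_const _
  refine measurable_of_isOpen fun s hs => ?_
  choose r hr0 hr using fun a : s => EMetric.isOpen_iff.1 hs a a.2
  obtain ⟨t, htc, ht⟩ := TopologicalSpace.isOpen_iUnion_countable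
    (fun a : s => Metric.eball (a : Lp ℝ p μ) (r a)) fun a => Metric.isOpen_eball
  have hst : s = ⋃ a ∈ t, Metric.eball (a : Lp ℝ p μ) (r a) := by
    rw [ht]
    exact Set.Subset.antisymm
      (fun a ha => Set.mem_iUnion.2 ⟨⟨a, ha⟩, Metric.mem_eball_self (hr0 ⟨a, ha⟩)⟩)
      (Set.iUnion_subset hr)
  rw [hst, Set.preimage_iUnion₂]
  exact MeasurableSet.biUnion htc fun a _ => measurableSet_lt (hdist a) measurable_const

theorem integral_le_of_lintegral_ofReal_le {Z : Type*} [MeasurableSpace Z] {μ : Measure Z}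
    {f : Z → ℝ} {a : ℝ} (ha : 0 ≤ a) (h : ∫⁻ z, ENNReal.ofReal (f z) ∂μ ≤ ENNReal.ofReal a) :
    ∫ z, f z ∂μ ≤ a := by
  by_cases hf : Integrable f μ
  · rw [integral_eq_lintegral_pos_part_sub_lintegral_neg_part hf]
    have := ENNReal.toReal_le_of_le_ofReal ha h
    linarith [ENNReal.toReal_nonneg (a := ∫⁻ z, ENNReal.ofReal (-f z) ∂μ)]
  -- The integral of a nonintegrable function is 0 by convention, which respects the bound since 0 ≤
  -- a.
  · rwa [integral_undef hf]

/-! ### One-stage operators and bounding functions -/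

namespace RobustMDP

section Stage

variable {E A Z : Type*} [MeasurableSpace E] [MeasurableSpace A] [MeasurableSpace Z] {q : ℝ≥0∞}
  {M : RobustMDP E A Z q} {α : ℝ} {bl bu : E → ℝ}

/-- Measurable functions between multiples of the bounding functions. -/
structure Bounded (bl bu v : E → ℝ) (C : ℝ) : Prop where
  measurable : Measurable v
  nonneg : 0 ≤ C
  lower : ∀ x, C * bl x ≤ v x
  upper : ∀ x, v x ≤ C * bu x

theorem measurable_stageCost {n : ℕ} (hc : Measurable (M.c n)) {v : E → ℝ} (hv : Measurable v) :
    Measurable (Function.uncurry (M.stageCost n v)) :=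
  (hc.comp (measurable_fst.prodMk (M.measurable_T n))).add (hv.comp (M.measurable_T n))

theorem MarkovPolicy.measurable_pair (d : M.MarkovPolicy) (n : ℕ) : Measurable (d.pair n) :=
  (measurable_id.prodMk (d.measurable_rule n)).subtype_mk

variable [TopologicalSpace E] [TopologicalSpace A]

namespace BoundingFunctions

theorem lower_nonpos (hb : M.BoundingFunctions α bl bu) (x : E) : bl x ≤ 0 := by
  obtain ⟨εl, εu, h1, -, -, h2, -⟩ := hb.bounds
  linarith [h2 x]

theorem upper_nonneg (hb : M.BoundingFunctions α bl bu) (x : E) : 0 ≤ bu x := by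
  obtain ⟨εl, εu, -, h1, -, -, h2⟩ := hb.bounds
  linarith [h2 x]

/-- From (c + v)^+ ≤ c^+ + C bu, the two assumptions on bu contribute the 1 and the Cα. The next
lemma is its mirror image for negative parts and bl. -/
theorem lintegral_stageCost_le (hb : M.BoundingFunctions α bl bu) {n : ℕ} (hn : n < M.N)
    (hc : Measurable (M.c n)) {v : E → ℝ} {C : ℝ} (hv : Bounded bl bu v C)
    {Q : DensityMeasure q (M.P n)} (hQ : Q ∈ M.𝒬 n) (xa : M.D n) :
    ∫⁻ z, ENNReal.ofReal (M.stageCost n v xa z) ∂Q.toMeasure ≤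
      ENNReal.ofReal ((1 + C * α) * bu xa.1.1) := by
  have hTm : Measurable fun z => M.T n (xa, z) := (M.measurable_T n).comp measurable_prodMk_left
  calc ∫⁻ z, ENNReal.ofReal (M.stageCost n v xa z) ∂Q.toMeasure
      ≤ ∫⁻ z, ENNReal.ofReal (M.c n (xa, M.T n (xa, z))) +
          ENNReal.ofReal C * ENNReal.ofReal (bu (M.T n (xa, z))) ∂Q.toMeasure := by
        refine lintegral_mono fun z => ?_
        rw [← ENNReal.ofReal_mul hv.nonneg]
        refine ENNReal.ofReal_add_le.trans ?_
        gcongr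
        exact hv.upper _
    _ = ∫⁻ z, ENNReal.ofReal (M.c n (xa, M.T n (xa, z))) ∂Q.toMeasure +
          ENNReal.ofReal C * ∫⁻ z, ENNReal.ofReal (bu (M.T n (xa, z))) ∂Q.toMeasure := by
        rw [lintegral_add_left, lintegral_const_mul]
        · exact (hb.measurable_upper.comp hTm).ennreal_ofReal
        · exact (hc.comp (measurable_const.prodMk hTm)).ennreal_ofReal
    _ ≤ ENNReal.ofReal (bu xa.1.1) + ENNReal.ofReal C * ENNReal.ofReal (α * bu xa.1.1) := by
        gcongr
        · exact hb.cost_pos n hn Q hQ xa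
        · exact hb.upper n hn Q hQ xa
    _ = _ := by
        have h1 := hb.upper_nonneg xa.1.1
        have h2 := hb.α_nonneg
        have h3 := hv.nonneg
        rw [← ENNReal.ofReal_mul h3, ← ENNReal.ofReal_add h1 (by positivity)]
        ring_nf

theorem lintegral_neg_stageCost_le (hb : M.BoundingFunctions α bl bu) {n : ℕ} (hn : n < M.N)
    (hc : Measurable (M.c n)) {v : E → ℝ} {C : ℝ} (hv : Bounded bl bu v C)
    {Q : DensityMeasure q (M.P n)} (hQ : Q ∈ M.𝒬 n) (xa : M.D n) :
    ∫⁻ z, ENNReal.ofReal (-M.stageCost n v xa z) ∂Q.toMeasure ≤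
      ENNReal.ofReal ((1 + C * α) * -bl xa.1.1) := by
  have hTm : Measurable fun z => M.T n (xa, z) := (M.measurable_T n).comp measurable_prodMk_left
  calc ∫⁻ z, ENNReal.ofReal (-M.stageCost n v xa z) ∂Q.toMeasure
      ≤ ∫⁻ z, ENNReal.ofReal (-M.c n (xa, M.T n (xa, z))) +
          ENNReal.ofReal C * ENNReal.ofReal (-bl (M.T n (xa, z))) ∂Q.toMeasure := by
        refine lintegral_mono fun z => ?_
        rw [← ENNReal.ofReal_mul hv.nonneg, stageCost, neg_add]
        refine ENNReal.ofReal_add_le.trans ?_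
        gcongr
        linarith [hv.lower (M.T n (xa, z))]
    _ = ∫⁻ z, ENNReal.ofReal (-M.c n (xa, M.T n (xa, z))) ∂Q.toMeasure +
          ENNReal.ofReal C * ∫⁻ z, ENNReal.ofReal (-bl (M.T n (xa, z))) ∂Q.toMeasure := by
        rw [lintegral_add_left, lintegral_const_mul]
        · exact (hb.measurable_lower.comp hTm).neg.ennreal_ofReal
        · exact (hc.comp (measurable_const.prodMk hTm)).neg.ennreal_ofReal
    _ ≤ ENNReal.ofReal (-bl xa.1.1) + ENNReal.ofReal C * ENNReal.ofReal (α * -bl xa.1.1) := by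
        gcongr
        · exact hb.cost_neg n hn Q hQ xa
        · exact hb.lower n hn Q hQ xa
    _ = _ := by
        have h1 : 0 ≤ -bl xa.1.1 := neg_nonneg.2 (hb.lower_nonpos xa.1.1)
        have h2 := hb.α_nonneg
        have h3 := hv.nonneg
        rw [← ENNReal.ofReal_mul h3, ← ENNReal.ofReal_add h1 (by positivity)]
        ring_nf

theorem one_add_mul_nonneg (hb : M.BoundingFunctions α bl bu) {v : E → ℝ} {C : ℝ}
    (hv : Bounded bl bu v C) : 0 ≤ 1 + C * α := by
  have h2 := hb.α_nonneg
  have h3 := hv.nonneg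
  positivity

theorem L_le (hb : M.BoundingFunctions α bl bu) {n : ℕ} (hn : n < M.N)
    (hc : Measurable (M.c n)) {v : E → ℝ} {C : ℝ} (hv : Bounded bl bu v C)
    {Q : DensityMeasure q (M.P n)} (hQ : Q ∈ M.𝒬 n) (xa : M.D n) :
    M.L n v xa Q ≤ (1 + C * α) * bu xa.1.1 :=
  integral_le_of_lintegral_ofReal_le
    (mul_nonneg (hb.one_add_mul_nonneg hv) (hb.upper_nonneg _))
    (hb.lintegral_stageCost_le hn hc hv hQ xa)

theorem le_L (hb : M.BoundingFunctions α bl bu) {n : ℕ} (hn : n < M.N)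
    (hc : Measurable (M.c n)) {v : E → ℝ} {C : ℝ} (hv : Bounded bl bu v C)
    {Q : DensityMeasure q (M.P n)} (hQ : Q ∈ M.𝒬 n) (xa : M.D n) :
    (1 + C * α) * bl xa.1.1 ≤ M.L n v xa Q := by
  have h := integral_le_of_lintegral_ofReal_le
    (mul_nonneg (hb.one_add_mul_nonneg hv) (neg_nonneg.2 (hb.lower_nonpos _)))
    (hb.lintegral_neg_stageCost_le hn hc hv hQ xa)
  rw [integral_neg] at h
  rw [L]
  linarith

/-- Local domination is evaluated at the point itself; since bl ≤ 0 ≤ bu, |v| ≤ C(bu - bl) ≤ C Θ₂.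
-/
theorem memLp_stageCost (hb : M.BoundingFunctions α bl bu) {n : ℕ} (hn : n < M.N)
    (hc : Measurable (M.c n)) {v : E → ℝ} {C : ℝ} (hv : Bounded bl bu v C) (xa : M.D n) :
    MemLp (M.stageCost n v xa) q.conjExponent (M.P n) := by
  obtain ⟨U, hU, Θ₁, Θ₂, -, -, h1, h2, hm1, hm2, hdom⟩ := hb.domination n hn xa
  have hm : Measurable (M.stageCost n v xa) :=
    (measurable_stageCost hc hv.measurable).comp measurable_prodMk_left
  refine (hm1.add (hm2.const_mul C)).mono' hm.aestronglyMeasurable (.of_forall fun z => ?_)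
  obtain ⟨h3, h4⟩ := hdom z xa (mem_of_mem_nhds hU)
  have h5 : |v (M.T n (xa, z))| ≤ C * Θ₂ z := by
    have h6 := hv.lower (M.T n (xa, z))
    have h7 := hv.upper (M.T n (xa, z))
    have h8 := mul_le_mul_of_nonneg_left h4 hv.nonneg
    have h9 := mul_nonneg hv.nonneg (hb.upper_nonneg (M.T n (xa, z)))
    have h10 := mul_nonneg hv.nonneg (neg_nonneg.2 (hb.lower_nonpos (M.T n (xa, z))))
    rw [abs_le]
    constructor <;> nlinarith
  exact (abs_add_le _ _).trans (add_le_add h3 h5)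

theorem integrable_stageCost [Fact (1 ≤ q)] (hb : M.BoundingFunctions α bl bu) {n : ℕ}
    (hn : n < M.N) (hc : Measurable (M.c n)) {v : E → ℝ} {C : ℝ} (hv : Bounded bl bu v C)
    (xa : M.D n) (Q : DensityMeasure q (M.P n)) : Integrable (M.stageCost n v xa) Q.toMeasure :=
  Q.integrable_of_memLp (hb.memLp_stageCost hn hc hv xa)

theorem bddAbove_L (hb : M.BoundingFunctions α bl bu) {n : ℕ} (hn : n < M.N)
    (hc : Measurable (M.c n)) {v : E → ℝ} {C : ℝ} (hv : Bounded bl bu v C) (xa : M.D n) :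
    BddAbove (Set.range fun Q : M.𝒬 n => M.L n v xa Q.1) := by
  refine ⟨(1 + C * α) * bu xa.1.1, ?_⟩
  rintro _ ⟨Q, rfl⟩
  exact hb.L_le hn hc hv Q.2 xa

/-- This factors the dependence on (x, a) through L^p, so that measurability and selection on L^p
transfer to the model. -/
theorem L_eq_pairing (hb : M.BoundingFunctions α bl bu) {n : ℕ} (hn : n < M.N)
    (hc : Measurable (M.c n)) {v : E → ℝ} {C : ℝ} (hv : Bounded bl bu v C) (xa : M.D n)
    (Q : DensityMeasure q (M.P n)) :
    M.L n v xa Q = Q.pairing (hb.memLp_stageCost hn hc hv xa).toLp :=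
  (Q.pairing_toLp _).symm

theorem measurable_toLp_stageCost [Fact (1 ≤ q)] (hq : 1 < q)
    (hb : M.BoundingFunctions α bl bu) {n : ℕ}
    (hn : n < M.N) (hc : Measurable (M.c n)) {v : E → ℝ} {C : ℝ} (hv : Bounded bl bu v C)
    [IsSeparable (M.P n)] [MeasurableSpace (Lp ℝ q.conjExponent (M.P n))]
    [BorelSpace (Lp ℝ q.conjExponent (M.P n))] :
    Measurable fun xa => (hb.memLp_stageCost hn hc hv xa).toLp :=
  measurable_toLp (conjExponent_ne_top hq) (measurable_stageCost hc hv.measurable) _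

/-- The robust operator of a decision rule preserves boundedness and measurability. -/
theorem bounded_opRobust [Fact (1 ≤ q)] (hq : 1 < q) (hb : M.BoundingFunctions α bl bu) {n : ℕ}
    (hn : n < M.N) (hc : Measurable (M.c n)) {v : E → ℝ} {C : ℝ} (hv : Bounded bl bu v C)
    [IsSeparable (M.P n)] {K : ℝ≥0} (hK : ∀ Q ∈ M.𝒬 n, eLpNorm Q.density q (M.P n) ≤ K)
    (d : M.MarkovPolicy) : Bounded bl bu (opRobust d n v) (1 + C * α) where
  measurable := by
    let _ : MeasurableSpace (Lp ℝ q.conjExponent (M.P n)) := borel _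
    have : BorelSpace (Lp ℝ q.conjExponent (M.P n)) := ⟨rfl⟩
    have h : opRobust d n v = fun x => ⨆ Q : M.𝒬 n,
        Q.1.pairing (hb.memLp_stageCost hn hc hv (d.pair n x)).toLp := by
      funext x
      simp only [opRobust, hb.L_eq_pairing hn hc hv]
    rw [h]
    exact (DensityMeasure.measurable_iSup_pairing hK).comp
      ((hb.measurable_toLp_stageCost hq hn hc hv).comp (d.measurable_pair n))
  nonneg := hb.one_add_mul_nonneg hv
  lower x := by
    obtain ⟨Q, hQ⟩ := M.nonempty_𝒬 n
    exact (hb.le_L hn hc hv hQ (d.pair n x)).trans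
      (le_ciSup (hb.bddAbove_L hn hc hv (d.pair n x)) ⟨Q, hQ⟩)
  upper x := by
    have : Nonempty (M.𝒬 n) := (M.nonempty_𝒬 n).to_subtype
    exact ciSup_le fun Q => hb.L_le hn hc hv Q.2 (d.pair n x)

/-- The operator of a pair of decision rules preserves boundedness and measurability. -/
theorem bounded_opNature (hb : M.BoundingFunctions α bl bu) {n : ℕ}
    (hn : n < M.N) (hc : Measurable (M.c n)) {v : E → ℝ} {C : ℝ} (hv : Bounded bl bu v C)
    (d : M.MarkovPolicy) (γ : M.MarkovNaturePolicy) :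
    Bounded bl bu (opNature d γ n v) (1 + C * α) where
  measurable := by
    let κ : Kernel E Z :=
      { toFun := fun x => (γ.rule n (d.pair n x)).1.toMeasure
        measurable' := DensityMeasure.measurable_toMeasure.comp
          (measurable_subtype_coe.comp ((γ.measurable_rule n).comp (d.measurable_pair n))) }
    have : IsMarkovKernel κ := ⟨fun x => (γ.rule n (d.pair n x)).1.isProb⟩
    have hm : StronglyMeasurable fun y : E × Z => M.stageCost n v (d.pair n y.1) y.2 :=
      ((measurable_stageCost hc hv.measurable).comp
        (((d.measurable_pair n).comp measurable_fst).prodMk measurable_snd)).stronglyMeasurable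
    exact (hm.integral_kernel_prod_right' (κ := κ)).measurable
  nonneg := hb.one_add_mul_nonneg hv
  lower x := hb.le_L hn hc hv (γ.rule n (d.pair n x)).2 (d.pair n x)
  upper x := hb.L_le hn hc hv (γ.rule n (d.pair n x)).2 (d.pair n x)

theorem bounded_cN (hb : M.BoundingFunctions α bl bu) (hcN : Measurable M.cN) :
    Bounded bl bu M.cN 1 :=
  ⟨hcN, zero_le_one, fun x => by simpa using (hb.terminal x).1,
    fun x => by simpa using (hb.terminal x).2⟩

end BoundingFunctions

end Stage

end RobustMDP

/-! ### Histories, accumulated costs and the one-step law -/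

namespace RobustMDP

section Histories

variable {E A Z : Type*} [MeasurableSpace E] [MeasurableSpace A] [MeasurableSpace Z] {q : ℝ≥0∞}
  {M : RobustMDP E A Z q}

/-- The cost accumulated from time `n` on. -/
noncomputable def Hist.running {m : ℕ} (n : ℕ) (h : M.Hist m) : ℝ :=
  ∑ k : Fin m, if n ≤ k then M.c k (h.stateAction k, h.state k.succ) else 0

/-- The absolute costs accumulated from time `n` on. -/
noncomputable def Hist.absRunning {m : ℕ} (n : ℕ) (h : M.Hist m) : ℝ≥0∞ :=
  ∑ k : Fin m, if n ≤ k then ‖M.c k (h.stateAction k, h.state k.succ)‖ₑ else 0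

@[simp]
theorem HistAction.last_extend {m : ℕ} (p : M.HistAction m) (y : E) :
    Hist.last (HistAction.extend (p, y)) = y := by
  simp [Hist.last, HistAction.extend]

theorem HistAction.stateAction_extend_castSucc {m : ℕ} (p : M.HistAction m) (y : E) (k : Fin m) :
    Hist.stateAction (HistAction.extend (p, y)) k.castSucc = Hist.stateAction p.1.1 k := by
  apply Subtype.ext
  apply Prod.ext
  · change Fin.snoc (α := fun _ => E) p.1.1.1.1 y (k.castSucc.castSucc) = p.1.1.1.1 k.castSucc
    rw [Fin.snoc_castSucc]
  · change Fin.snoc (α := fun _ => A) p.1.1.1.2 p.1.2 (k.castSucc) = p.1.1.1.2 k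
    rw [Fin.snoc_castSucc]

theorem HistAction.state_extend_castSucc {m : ℕ} (p : M.HistAction m) (y : E) (k : Fin m) :
    Hist.state (HistAction.extend (p, y)) k.castSucc.succ = Hist.state p.1.1 k.succ := by
  change Fin.snoc (α := fun _ => E) p.1.1.1.1 y (k.succ.castSucc) = p.1.1.1.1 k.succ
  rw [Fin.snoc_castSucc]

theorem HistAction.stateAction_extend_last {m : ℕ} (p : M.HistAction m) (y : E) :
    Hist.stateAction (HistAction.extend (p, y)) (Fin.last m) = p.current := by
  apply Subtype.ext
  apply Prod.ext
  · change Fin.snoc (α := fun _ => E) p.1.1.1.1 y (Fin.last m).castSucc = p.1.1.1.1 (Fin.last m)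
    rw [Fin.snoc_castSucc]
  · change Fin.snoc (α := fun _ => A) p.1.1.1.2 p.1.2 (Fin.last m) = p.1.2
    rw [Fin.snoc_last]

theorem HistAction.state_extend_last {m : ℕ} (p : M.HistAction m) (y : E) :
    Hist.state (HistAction.extend (p, y)) (Fin.last m).succ = y :=
  HistAction.last_extend p y

theorem HistAction.running_extend {m n : ℕ} (hnm : n ≤ m) (p : M.HistAction m) (y : E) :
    Hist.running n (HistAction.extend (p, y)) = Hist.running n p.1.1 + M.c m (p.current, y) := by
  rw [Hist.running, Fin.sum_univ_castSucc]
  congr 1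
  · refine Finset.sum_congr rfl fun k _ => ?_
    simp only [Fin.val_castSucc]
    rw [← stateAction_extend_castSucc p y k, ← state_extend_castSucc p y k]
  · rw [if_pos (by simpa using hnm), ← stateAction_extend_last p y, state_extend_last]
    rfl

theorem HistAction.absRunning_extend {m n : ℕ} (hnm : n ≤ m) (p : M.HistAction m) (y : E) :
    Hist.absRunning n (HistAction.extend (p, y)) =
      Hist.absRunning n p.1.1 + ‖M.c m (p.current, y)‖ₑ := by
  rw [Hist.absRunning, Fin.sum_univ_castSucc]
  congr 1
  · refine Finset.sum_congr rfl fun k _ => ?_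
    simp only [Fin.val_castSucc]
    rw [← stateAction_extend_castSucc p y k, ← state_extend_castSucc p y k]
  · rw [if_pos (by simpa using hnm), ← stateAction_extend_last p y, state_extend_last]
    rfl

theorem Hist.running_self {n : ℕ} (h : M.Hist n) : h.running n = 0 :=
  Finset.sum_eq_zero fun k _ => if_neg (by simp)

theorem Hist.absRunning_self {n : ℕ} (h : M.Hist n) : h.absRunning n = 0 :=
  Finset.sum_eq_zero fun k _ => if_neg (by simp)

theorem Hist.enorm_running_le {m : ℕ} (n : ℕ) (h : M.Hist m) :
    ‖h.running n‖ₑ ≤ h.absRunning n := by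
  refine (enorm_sum_le _ _).trans (Finset.sum_le_sum fun k _ => ?_)
  split_ifs <;> simp

theorem Hist.measurable_term {m : ℕ} (k : Fin m) (hc : Measurable (M.c k)) :
    Measurable fun h : M.Hist m => M.c k (h.stateAction k, h.state k.succ) := by
  refine hc.comp (Measurable.prodMk (Measurable.subtype_mk ?_) ?_)
  · exact ((measurable_pi_apply _).comp (measurable_fst.comp measurable_subtype_coe)).prodMk
      ((measurable_pi_apply _).comp (measurable_snd.comp measurable_subtype_coe))
  · exact (measurable_pi_apply _).comp (measurable_fst.comp measurable_subtype_coe)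

theorem Hist.measurable_running {m : ℕ} (n : ℕ) (hc : ∀ k < m, Measurable (M.c k)) :
    Measurable (Hist.running n : M.Hist m → ℝ) := by
  refine Finset.measurable_sum _ fun k _ => ?_
  split_ifs
  · exact Hist.measurable_term k (hc k k.2)
  · exact measurable_const

theorem Hist.measurable_absRunning {m : ℕ} (n : ℕ) (hc : ∀ k < m, Measurable (M.c k)) :
    Measurable (Hist.absRunning n : M.Hist m → ℝ≥0∞) := by
  refine Finset.measurable_sum _ fun k _ => ?_
  split_ifs
  · exact (Hist.measurable_term k (hc k k.2)).enorm
  · exact measurable_const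

/-- The pair `(h_n, d_n(x_n))`. -/
def MarkovPolicy.histAction (d : M.MarkovPolicy) {n : ℕ} (h : M.Hist n) : M.HistAction n :=
  ⟨(h, d.rule n h.last), d.feasible n h.last⟩

theorem MarkovPolicy.toRandomized_histAction (d : M.MarkovPolicy) (n : ℕ) (h : M.Hist n) :
    d.toRandomized.histAction n h = Measure.dirac (d.histAction h) := by
  ext s hs
  have he := MeasurableEmbedding.subtype_coe (M.measurableSet_histAction n)
  have hk : d.toRandomized.kernel n h = Measure.dirac (d.rule n h.last) :=
    Kernel.deterministic_apply ((d.measurable_rule n).comp Hist.measurable_last) h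
  -- `comapRight` measures s by its image among all pairs, where the product of two Dirac measures
  -- is a Dirac measure.
  rw [RandomizedPolicy.histAction, Kernel.comapRight_apply' _ _ _ hs, Kernel.prod_apply,
    Kernel.id_apply, hk, Measure.dirac_prod_dirac,
    Measure.dirac_apply' _ (he.measurableSet_image' hs), Measure.dirac_apply' _ hs]
  have : (h, d.rule n h.last) ∈ (Subtype.val '' s : Set (M.Hist n × A)) ↔ d.histAction h ∈ s := by
    constructor
    · rintro ⟨p, hp, hpe⟩
      have : p = d.histAction h := Subtype.ext hpe
      rwa [← this]
    · exact fun hp => ⟨_, hp, rfl⟩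
  by_cases hp : d.histAction h ∈ s
  · rw [Set.indicator_of_mem hp]
    exact Set.indicator_of_mem (this.2 hp) _
  · rw [Set.indicator_of_notMem hp]
    exact Set.indicator_of_notMem (fun h' => hp (this.1 h')) _

/-- The history following `h` under the decision rule `d_n` and the disturbance `z`. -/
def MarkovPolicy.next (d : M.MarkovPolicy) {n : ℕ} (h : M.Hist n) (z : Z) : M.Hist (n + 1) :=
  HistAction.extend (d.histAction h, M.T n (d.pair n h.last, z))

theorem MarkovPolicy.measurable_next (d : M.MarkovPolicy) {n : ℕ} (h : M.Hist n) :
    Measurable (d.next h) :=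
  HistAction.measurable_extend.comp
    (measurable_const.prodMk ((M.measurable_T n).comp measurable_prodMk_left))

theorem NaturePolicy.measurable_transition_map (n : ℕ) :
    Measurable fun p : M.HistAction n × Z => M.T n (p.1.current, p.2) :=
  (M.measurable_T n).comp
    ((HistAction.measurable_current.comp measurable_fst).prodMk measurable_snd)

instance (γ : M.NaturePolicy) (n : ℕ) : IsMarkovKernel (γ.transition n) :=
  Kernel.IsMarkovKernel.map _ (NaturePolicy.measurable_transition_map n)

/-- For a deterministic controller all other factors are Dirac, so the disturbance is the only
source of randomness. -/
theorem step_toRandomized (d : M.MarkovPolicy) (γ : M.NaturePolicy) (n : ℕ) (h : M.Hist n) :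
    step d.toRandomized γ n h =
      Measure.map (d.next h) (γ.rule n (d.histAction h)).1.toMeasure := by
  have hT := NaturePolicy.measurable_transition_map (M := M) n
  rw [step, Kernel.map_apply _ HistAction.measurable_extend, Kernel.comp_apply,
    MarkovPolicy.toRandomized_histAction, Measure.dirac_bind (Kernel.measurable _),
    Kernel.prod_apply, Kernel.id_apply, NaturePolicy.transition, Kernel.map_apply _ hT,
    Kernel.prod_apply, Kernel.id_apply, Measure.dirac_prod, Measure.dirac_prod,
    Measure.map_map hT measurable_prodMk_left,
    Measure.map_map measurable_prodMk_left (hT.comp measurable_prodMk_left),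
    Measure.map_map HistAction.measurable_extend
      (measurable_prodMk_left.comp (hT.comp measurable_prodMk_left))]
  rfl

instance (d : M.MarkovPolicy) (γ : M.NaturePolicy) (n : ℕ) :
    IsMarkovKernel (step d.toRandomized γ n) :=
  ⟨fun h => by
    rw [step_toRandomized]
    exact Measure.isProbabilityMeasure_map (d.measurable_next h).aemeasurable⟩

instance (d : M.MarkovPolicy) (γ : M.NaturePolicy) (n k : ℕ) :
    IsMarkovKernel (law d.toRandomized γ n k) := by
  induction k with
  | zero => rw [law]; infer_instance
  | succ k ih => rw [law]; infer_instance

theorem lintegral_step (d : M.MarkovPolicy) (γ : M.NaturePolicy) (n : ℕ) (h : M.Hist n)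
    {f : M.Hist (n + 1) → ℝ≥0∞} (hf : Measurable f) :
    ∫⁻ h', f h' ∂step d.toRandomized γ n h =
      ∫⁻ z, f (d.next h z) ∂(γ.rule n (d.histAction h)).1.toMeasure := by
  rw [step_toRandomized, lintegral_map hf (d.measurable_next h)]

theorem integral_step (d : M.MarkovPolicy) (γ : M.NaturePolicy) (n : ℕ) (h : M.Hist n)
    {f : M.Hist (n + 1) → ℝ} (hf : Measurable f) :
    ∫ h', f h' ∂step d.toRandomized γ n h =
      ∫ z, f (d.next h z) ∂(γ.rule n (d.histAction h)).1.toMeasure := by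
  rw [step_toRandomized, integral_map (d.measurable_next h).aemeasurable hf.aestronglyMeasurable]

theorem Hist.measurable_running_add (hc : ∀ k < M.N, Measurable (M.c k)) {v : E → ℝ}
    (hv : Measurable v) (n : ℕ) {m : ℕ} (hm : m ≤ M.N) :
    Measurable fun h' : M.Hist m => h'.running n + v h'.last :=
  (Hist.measurable_running n fun k hk => hc k (hk.trans_le hm)).add (hv.comp Hist.measurable_last)

end Histories

/-! ### Integrability and comparison along the law of motion -/

section Law

variable {E A Z : Type*} [MeasurableSpace E] [MeasurableSpace A] [MeasurableSpace Z] {q : ℝ≥0∞}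
  {M : RobustMDP E A Z q} {α : ℝ} {bl bu : E → ℝ} [TopologicalSpace E] [TopologicalSpace A]

namespace BoundingFunctions

theorem lintegral_absolute_le (hb : M.BoundingFunctions α bl bu) {n : ℕ} (hn : n < M.N)
    (hc : Measurable (M.c n)) {Q : DensityMeasure q (M.P n)} (hQ : Q ∈ M.𝒬 n) (xa : M.D n)
    {C : ℝ} (hC : 0 ≤ C) :
    ∫⁻ z, (‖M.c n (xa, M.T n (xa, z))‖ₑ +
        ENNReal.ofReal (C * (bu (M.T n (xa, z)) - bl (M.T n (xa, z))))) ∂Q.toMeasure ≤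
      ENNReal.ofReal ((1 + C * α) * (bu xa.1.1 - bl xa.1.1)) := by
  have hTm : Measurable fun z => M.T n (xa, z) := (M.measurable_T n).comp measurable_prodMk_left
  have hcm : Measurable fun z => M.c n (xa, M.T n (xa, z)) := hc.comp (measurable_const.prodMk hTm)
  have hum : Measurable fun z => bu (M.T n (xa, z)) := hb.measurable_upper.comp hTm
  have hlm : Measurable fun z => bl (M.T n (xa, z)) := hb.measurable_lower.comp hTm
  have h1 := hb.upper_nonneg xa.1.1
  have h2 : 0 ≤ -bl xa.1.1 := neg_nonneg.2 (hb.lower_nonpos xa.1.1)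
  have h3 := hb.α_nonneg
  have habs : ∀ a : ℝ, ‖a‖ₑ = ENNReal.ofReal a + ENNReal.ofReal (-a) := by
    intro a
    rcases le_total 0 a with ha | ha
    · rw [ENNReal.ofReal_of_nonpos (neg_nonpos.2 ha), add_zero, Real.enorm_of_nonneg ha]
    · rw [ENNReal.ofReal_of_nonpos ha, zero_add, ← enorm_neg,
        Real.enorm_of_nonneg (neg_nonneg.2 ha)]
  have hsplit : ∀ z, ‖M.c n (xa, M.T n (xa, z))‖ₑ +
        ENNReal.ofReal (C * (bu (M.T n (xa, z)) - bl (M.T n (xa, z)))) =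
      (ENNReal.ofReal (M.c n (xa, M.T n (xa, z))) + ENNReal.ofReal (-M.c n (xa, M.T n (xa, z)))) +
        ENNReal.ofReal C * (ENNReal.ofReal (bu (M.T n (xa, z))) +
          ENNReal.ofReal (-bl (M.T n (xa, z)))) := by
    intro z
    rw [habs, ← ENNReal.ofReal_add (hb.upper_nonneg _) (neg_nonneg.2 (hb.lower_nonpos _)),
      ← ENNReal.ofReal_mul hC, sub_eq_add_neg]
  have hm1 : Measurable fun z => ENNReal.ofReal (M.c n (xa, M.T n (xa, z))) +
      ENNReal.ofReal (-M.c n (xa, M.T n (xa, z))) :=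
    hcm.ennreal_ofReal.add hcm.neg.ennreal_ofReal
  have hm2 : Measurable fun z => ENNReal.ofReal (bu (M.T n (xa, z))) +
      ENNReal.ofReal (-bl (M.T n (xa, z))) := hum.ennreal_ofReal.add hlm.neg.ennreal_ofReal
  simp_rw [hsplit]
  rw [lintegral_add_left hm1, lintegral_add_left hcm.ennreal_ofReal, lintegral_const_mul _ hm2,
    lintegral_add_left hum.ennreal_ofReal]
  calc _ ≤ (ENNReal.ofReal (bu xa.1.1) + ENNReal.ofReal (-bl xa.1.1)) + ENNReal.ofReal C *
        (ENNReal.ofReal (α * bu xa.1.1) + ENNReal.ofReal (α * -bl xa.1.1)) := by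
        gcongr
        · exact hb.cost_pos n hn Q hQ xa
        · exact hb.cost_neg n hn Q hQ xa
        · exact hb.upper n hn Q hQ xa
        · exact hb.lower n hn Q hQ xa
    _ = _ := by
        rw [← ENNReal.ofReal_add h1 h2, ← ENNReal.ofReal_add (by positivity) (by positivity),
          ← ENNReal.ofReal_mul hC, ← ENNReal.ofReal_add (by positivity) (by positivity)]
        ring_nf

/-- C is quantified inside the induction because integrating out the last stage turns the weight C
on bu - bl into 1 + Cα. -/
theorem lintegral_absRunning_lt_top (hb : M.BoundingFunctions α bl bu)
    (hc : ∀ k < M.N, Measurable (M.c k)) (d : M.MarkovPolicy) (γ : M.NaturePolicy) (n : ℕ)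
    (h : M.Hist n) (k : ℕ) : n + k ≤ M.N → ∀ C : ℝ, 0 ≤ C →
    ∫⁻ h', (h'.absRunning n + ENNReal.ofReal (C * (bu h'.last - bl h'.last)))
      ∂law d.toRandomized γ n k h < ∞ := by
  have hmeas : ∀ m ≤ M.N, ∀ C : ℝ, Measurable fun h' : M.Hist m =>
      h'.absRunning n + ENNReal.ofReal (C * (bu h'.last - bl h'.last)) := fun m hm C =>
    (Hist.measurable_absRunning n fun k hk => hc k (hk.trans_le hm)).add
      (((hb.measurable_upper.comp Hist.measurable_last).sub
        (hb.measurable_lower.comp Hist.measurable_last)).const_mul C).ennreal_ofReal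
  induction k with
  | zero =>
    intro hk C _
    rw [law, Kernel.id_apply]
    refine lt_of_eq_of_lt (lintegral_dirac' (α := M.Hist n) h (hmeas n hk C)) ?_
    change h.absRunning n + _ < ∞
    rw [Hist.absRunning_self, zero_add]
    exact ENNReal.ofReal_lt_top
  | succ k ih =>
    intro hk C hC
    have hlt : n + k < M.N := hk
    rw [law, Kernel.lintegral_comp _ _ _ (hmeas _ hk C)]
    refine lt_of_le_of_lt (lintegral_mono fun h' => ?_)
      (ih hlt.le (1 + C * α) (by have := hb.α_nonneg; positivity))
    refine (lintegral_step d γ (n + k) h' (hmeas (n + k + 1) hk C)).le.trans ?_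
    simp only [MarkovPolicy.next, HistAction.last_extend,
      HistAction.absRunning_extend (Nat.le_add_right n k), add_assoc]
    have hm' : Measurable fun _ : Z => h'.absRunning n := measurable_const
    change ∫⁻ z, h'.absRunning n + _ ∂_ ≤ _
    rw [lintegral_add_left hm', lintegral_const, measure_univ, mul_one]
    gcongr
    exact hb.lintegral_absolute_le hlt (hc _ hlt) (γ.rule _ _).2 (d.pair (n + k) h'.last) hC

theorem integrable_running_add (hb : M.BoundingFunctions α bl bu)
    (hc : ∀ k < M.N, Measurable (M.c k)) (d : M.MarkovPolicy) (γ : M.NaturePolicy) {n k : ℕ}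
    (hk : n + k ≤ M.N) (h : M.Hist n) {v : E → ℝ} {C : ℝ} (hv : Bounded bl bu v C) :
    Integrable (fun h' => h'.running n + v h'.last) (law d.toRandomized γ n k h) := by
  refine ⟨(Hist.measurable_running_add hc hv.measurable n hk).aestronglyMeasurable, ?_⟩
  refine lt_of_le_of_lt (lintegral_mono fun h' => ?_)
    (hb.lintegral_absRunning_lt_top hc d γ n h k hk C hv.nonneg)
  refine (enorm_add_le _ _).trans (add_le_add (Hist.enorm_running_le n h') ?_)
  rw [← ofReal_norm, Real.norm_eq_abs]
  refine ENNReal.ofReal_le_ofReal (abs_le.2 ⟨?_, ?_⟩)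
  · have := mul_nonneg hv.nonneg (hb.upper_nonneg h'.last)
    linarith [hv.lower h'.last]
  · have := mul_nonneg hv.nonneg (neg_nonneg.2 (hb.lower_nonpos h'.last))
    linarith [hv.upper h'.last]

theorem integral_step_running_add [Fact (1 ≤ q)] (hb : M.BoundingFunctions α bl bu)
    (hc : ∀ k < M.N, Measurable (M.c k)) (d : M.MarkovPolicy) (γ : M.NaturePolicy) {n m : ℕ}
    (hnm : n ≤ m) (hm : m < M.N) {v : E → ℝ} {C : ℝ} (hv : Bounded bl bu v C) (h : M.Hist m) :
    ∫ h', (h'.running n + v h'.last) ∂step d.toRandomized γ m h =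
      h.running n + M.L m v (d.pair m h.last) (γ.rule m (d.histAction h)).1 := by
  rw [integral_step _ _ _ _ (Hist.measurable_running_add hc hv.measurable n hm)]
  simp only [MarkovPolicy.next, HistAction.last_extend, HistAction.running_extend hnm, add_assoc]
  change ∫ z, h.running n + M.stageCost m v (d.pair m h.last) z ∂_ = _
  rw [integral_add (integrable_const _) (hb.integrable_stageCost hm (hc m hm) hv _ _),
    integral_const, probReal_univ, one_smul]
  rfl

/-- Conditioning on the history at time n + k: Fubini for the composed kernel, with the inner
integral given by `integral_step_running_add`. -/
theorem integral_law_succ [Fact (1 ≤ q)] (hb : M.BoundingFunctions α bl bu)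
    (hc : ∀ k < M.N, Measurable (M.c k)) (d : M.MarkovPolicy) (γ : M.NaturePolicy) {n k : ℕ}
    (hk : n + k < M.N) (h : M.Hist n) {v : E → ℝ} {C : ℝ} (hv : Bounded bl bu v C) :
    Integrable (fun h' => h'.running n +
      M.L (n + k) v (d.pair (n + k) h'.last) (γ.rule (n + k) (d.histAction h')).1)
        (law d.toRandomized γ n k h) ∧
    ∫ h', (h'.running n + v h'.last) ∂law d.toRandomized γ n (k + 1) h =
      ∫ h', (h'.running n +
        M.L (n + k) v (d.pair (n + k) h'.last) (γ.rule (n + k) (d.histAction h')).1)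
          ∂law d.toRandomized γ n k h := by
  have hint : Integrable (fun h' : M.Hist (n + k + 1) => h'.running n + v h'.last)
      ((step d.toRandomized γ (n + k) ∘ₖ law d.toRandomized γ n k) h) :=
    hb.integrable_running_add hc d γ (k := k + 1) hk h hv
  simp_rw [← hb.integral_step_running_add hc d γ (Nat.le_add_right n k) hk hv]
  exact ⟨hint.integral_comp, Kernel.integral_comp hint⟩

/-- A family of functions dominating the one-stage operators of nature dominates the values. -/
theorem V_le [Fact (1 ≤ q)] (hb : M.BoundingFunctions α bl bu)
    (hc : ∀ k < M.N, Measurable (M.c k)) (d : M.MarkovPolicy) (γ : M.NaturePolicy)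
    {U : ℕ → E → ℝ} (hU : ∀ n ≤ M.N, ∃ C, Bounded bl bu (U n) C) (hUN : U M.N = M.cN)
    (hstep : ∀ n < M.N, ∀ h : M.Hist n,
      M.L n (U (n + 1)) (d.pair n h.last) (γ.rule n (d.histAction h)).1 ≤ U n h.last)
    {n : ℕ} (hn : n ≤ M.N) (h : M.Hist n) : V d.toRandomized γ n h ≤ U n h.last := by
  -- A supermartingale argument: this expectation does not increase with k. It starts at U n, as no
  -- cost has accumulated, and ends at V because U equals c_N at the horizon.
  have key : ∀ k, n + k ≤ M.N →
      ∫ h', (h'.running n + U (n + k) h'.last) ∂law d.toRandomized γ n k h ≤ U n h.last := by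
    intro k
    induction k with
    | zero =>
      intro hk
      obtain ⟨C, hC⟩ := hU n hn
      rw [law, Kernel.id_apply]
      refine (integral_dirac' (α := M.Hist n) _ h
        (Hist.measurable_running_add hc hC.measurable n hk).stronglyMeasurable).le.trans ?_
      change h.running n + U n h.last ≤ U n h.last
      rw [Hist.running_self, zero_add]
    | succ k ih =>
      intro hk
      have hlt : n + k < M.N := hk
      obtain ⟨C, hC⟩ := hU (n + k + 1) hk
      obtain ⟨C', hC'⟩ := hU (n + k) hlt.le
      obtain ⟨h1, h2⟩ := hb.integral_law_succ hc d γ hlt h hC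
      refine (h2.le.trans ?_).trans (ih hlt.le)
      exact integral_mono h1 (hb.integrable_running_add hc d γ hlt.le h hC')
        fun h' => add_le_add le_rfl (hstep _ hlt h')
  have h1 := key (M.N - n) (by omega)
  have h2 : n + (M.N - n) = M.N := by omega
  have h3 : U (n + (M.N - n)) = M.cN := by rw [h2, hUN]
  rw [h3] at h1
  exact h1

/-- A family of functions solving the recursion of nature's policy is the value. -/
theorem V_eq [Fact (1 ≤ q)] (hb : M.BoundingFunctions α bl bu)
    (hc : ∀ k < M.N, Measurable (M.c k)) (d : M.MarkovPolicy) (γ : M.NaturePolicy)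
    {U : ℕ → E → ℝ} (hU : ∀ n ≤ M.N, ∃ C, Bounded bl bu (U n) C) (hUN : U M.N = M.cN)
    (hstep : ∀ n < M.N, ∀ h : M.Hist n,
      M.L n (U (n + 1)) (d.pair n h.last) (γ.rule n (d.histAction h)).1 = U n h.last)
    {n : ℕ} (hn : n ≤ M.N) (h : M.Hist n) : V d.toRandomized γ n h = U n h.last := by
  have key : ∀ k, n + k ≤ M.N →
      ∫ h', (h'.running n + U (n + k) h'.last) ∂law d.toRandomized γ n k h = U n h.last := by
    intro k
    induction k with
    | zero =>
      intro hk
      obtain ⟨C, hC⟩ := hU n hn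
      rw [law, Kernel.id_apply]
      refine (integral_dirac' (α := M.Hist n) _ h
        (Hist.measurable_running_add hc hC.measurable n hk).stronglyMeasurable).trans ?_
      change h.running n + U n h.last = U n h.last
      rw [Hist.running_self, zero_add]
    | succ k ih =>
      intro hk
      have hlt : n + k < M.N := hk
      obtain ⟨C, hC⟩ := hU (n + k + 1) hk
      refine ((hb.integral_law_succ hc d γ hlt h hC).2.trans ?_).trans (ih hlt.le)
      exact integral_congr_ae (.of_forall fun h' => congrArg _ (hstep _ hlt h'))
  have h1 := key (M.N - n) (by omega)
  have h2 : n + (M.N - n) = M.N := by omega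
  have h3 : U (n + (M.N - n)) = M.cN := by rw [h2, hUN]
  rw [h3] at h1
  exact h1

end BoundingFunctions

end Law

end RobustMDP

/-! ### Robust value iteration compared with the values -/

namespace RobustMDP

section RobustValue

variable {E A Z : Type*} [MeasurableSpace E] [MeasurableSpace A] [MeasurableSpace Z] {q : ℝ≥0∞}
  {M : RobustMDP E A Z q} {α : ℝ} {bl bu : E → ℝ}

/-- Robust value iteration at time `n` with `k` remaining stages. -/
noncomputable def robustValueToGo (d : M.MarkovPolicy) : ℕ → ℕ → E → ℝ
  | 0, _ => M.cN
  | k + 1, n => opRobust d n (robustValueToGo d k (n + 1))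

/-- Robust value iteration. -/
noncomputable def robustIteration (d : M.MarkovPolicy) (n : ℕ) : E → ℝ :=
  robustValueToGo d (M.N - n) n

theorem robustIteration_horizon (d : M.MarkovPolicy) : robustIteration d M.N = M.cN := by
  rw [robustIteration, Nat.sub_self, robustValueToGo]

theorem robustIteration_of_lt (d : M.MarkovPolicy) {n : ℕ} (hn : n < M.N) :
    robustIteration d n = opRobust d n (robustIteration d (n + 1)) := by
  rw [robustIteration, robustIteration, show M.N - n = M.N - (n + 1) + 1 by omega, robustValueToGo]

theorem J_horizon (d : M.MarkovPolicy) (γ : M.MarkovNaturePolicy) : J d γ M.N = M.cN := by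
  rw [J, Nat.sub_self, valueToGo]

theorem J_of_lt (d : M.MarkovPolicy) (γ : M.MarkovNaturePolicy) {n : ℕ} (hn : n < M.N) :
    J d γ n = opNature d γ n (J d γ (n + 1)) := by
  rw [J, J, show M.N - n = M.N - (n + 1) + 1 by omega, valueToGo]

/-- Decision rules of nature for the stages before the horizon extend to a policy. -/
theorem exists_markovNaturePolicy {p : ∀ n, (M.D n → M.𝒬 n) → Prop}
    (h : ∀ n < M.N, ∃ r : M.D n → M.𝒬 n, Measurable r ∧ p n r) :
    ∃ γ : M.MarkovNaturePolicy, ∀ n < M.N, p n (γ.rule n) := by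
  have h' : ∀ n, ∃ r : M.D n → M.𝒬 n, Measurable r ∧ (n < M.N → p n r) := by
    intro n
    by_cases hn : n < M.N
    · obtain ⟨r, h1, h2⟩ := h n hn
      exact ⟨r, h1, fun _ => h2⟩
    · exact ⟨fun _ => ⟨_, (M.nonempty_𝒬 n).choose_spec⟩, measurable_const, fun h => absurd h hn⟩
  choose r h1 h2 using h'
  exact ⟨⟨r, h1⟩, h2⟩

instance : Nonempty M.MarkovNaturePolicy :=
  ⟨⟨fun n _ => ⟨_, (M.nonempty_𝒬 n).choose_spec⟩, fun _ => measurable_const⟩⟩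

theorem exists_bounded {U : ℕ → E → ℝ} (hUN : ∃ C, Bounded bl bu (U M.N) C)
    (hU : ∀ n < M.N, ∀ C, Bounded bl bu (U (n + 1)) C → ∃ C', Bounded bl bu (U n) C') :
    ∀ n ≤ M.N, ∃ C, Bounded bl bu (U n) C := fun _ hn =>
  Nat.decreasingInduction' (fun k hk _ ⟨C, hC⟩ => hU k hk C hC) hn hUN

variable [TopologicalSpace E] [TopologicalSpace A]

namespace BoundingFunctions

theorem bounded_J (hb : M.BoundingFunctions α bl bu) (hc : ∀ k < M.N, Measurable (M.c k))
    (hcN : Measurable M.cN) (d : M.MarkovPolicy) (γ : M.MarkovNaturePolicy) :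
    ∀ n ≤ M.N, ∃ C, Bounded bl bu (J d γ n) C := by
  refine exists_bounded ⟨1, by rw [J_horizon]; exact hb.bounded_cN hcN⟩ fun n hn C hC => ?_
  rw [J_of_lt d γ hn]
  exact ⟨_, hb.bounded_opNature hn (hc n hn) hC d γ⟩

theorem L_le_robustIteration (hb : M.BoundingFunctions α bl bu)
    (hc : ∀ k < M.N, Measurable (M.c k)) {d : M.MarkovPolicy}
    (hW : ∀ n ≤ M.N, ∃ C, Bounded bl bu (robustIteration d n) C) {n : ℕ} (hn : n < M.N) (x : E)
    (Q : M.𝒬 n) : M.L n (robustIteration d (n + 1)) (d.pair n x) Q.1 ≤ robustIteration d n x := by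
  obtain ⟨C, hC⟩ := hW (n + 1) hn
  rw [robustIteration_of_lt d hn]
  exact le_ciSup (hb.bddAbove_L hn (hc n hn) hC (d.pair n x)) Q

variable [Fact (1 ≤ q)]

/-- The recursive values of Markov policies are their expected costs. -/
theorem J_eq_V (hb : M.BoundingFunctions α bl bu) (hc : ∀ k < M.N, Measurable (M.c k))
    (hcN : Measurable M.cN) (d : M.MarkovPolicy) (γ : M.MarkovNaturePolicy) {n : ℕ} (hn : n ≤ M.N)
    (h : M.Hist n) : J d γ n h.last = V d.toRandomized γ.toNature n h := by
  refine (hb.V_eq hc d γ.toNature (hb.bounded_J hc hcN d γ) (J_horizon d γ)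
    (fun n hn h => ?_) hn h).symm
  rw [J_of_lt d γ hn]
  rfl

theorem bounded_robustIteration (hq : 1 < q) (hb : M.BoundingFunctions α bl bu)
    (hc : ∀ k < M.N, Measurable (M.c k)) (hcN : Measurable M.cN)
    (hsep : ∀ n < M.N, IsSeparable (M.P n)) (hbdd : M.NormBounded) (d : M.MarkovPolicy) :
    ∀ n ≤ M.N, ∃ C, Bounded bl bu (robustIteration d n) C := by
  obtain ⟨K, hK⟩ := hbdd
  refine exists_bounded ⟨1, by rw [robustIteration_horizon]; exact hb.bounded_cN hcN⟩
    fun n hn C hC => ?_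
  have := hsep n hn
  rw [robustIteration_of_lt d hn]
  exact ⟨_, hb.bounded_opRobust hq hn (hc n hn) hC (hK n hn) d⟩

theorem V_le_robustIteration (hb : M.BoundingFunctions α bl bu)
    (hc : ∀ k < M.N, Measurable (M.c k)) {d : M.MarkovPolicy}
    (hW : ∀ n ≤ M.N, ∃ C, Bounded bl bu (robustIteration d n) C) (γ : M.NaturePolicy)
    {n : ℕ} (hn : n ≤ M.N) (h : M.Hist n) :
    V d.toRandomized γ n h ≤ robustIteration d n h.last :=
  hb.V_le hc d γ hW (robustIteration_horizon d)
    (fun _ hn h => hb.L_le_robustIteration hc hW hn h.last _) hn h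

/-- Backward induction by monotonicity of the one-stage integral; it works at every state without
constructing a history ending there. -/
theorem J_le_robustIteration (hb : M.BoundingFunctions α bl bu)
    (hc : ∀ k < M.N, Measurable (M.c k)) (hcN : Measurable M.cN) {d : M.MarkovPolicy}
    (hW : ∀ n ≤ M.N, ∃ C, Bounded bl bu (robustIteration d n) C) (γ : M.MarkovNaturePolicy)
    {n : ℕ} (hn : n ≤ M.N) (x : E) : J d γ n x ≤ robustIteration d n x := by
  refine Nat.decreasingInduction' (P := fun n => ∀ x, J d γ n x ≤ robustIteration d n x)
    (fun k hk _ ih x => ?_) hn (fun x => by rw [J_horizon, robustIteration_horizon]) x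
  obtain ⟨C, hC⟩ := hW (k + 1) hk
  obtain ⟨C', hC'⟩ := hb.bounded_J hc hcN d γ (k + 1) hk
  rw [J_of_lt d γ hk]
  refine le_trans ?_ (hb.L_le_robustIteration hc hW hk x (γ.rule k (d.pair k x)))
  exact integral_mono (hb.integrable_stageCost hk (hc k hk) hC' _ _)
    (hb.integrable_stageCost hk (hc k hk) hC _ _) fun z => add_le_add le_rfl (ih _)

/-- If nature loses at most `δ` at each stage, it loses at most `δ` per remaining stage. -/
theorem robustIteration_sub_le_J (hb : M.BoundingFunctions α bl bu)
    (hc : ∀ k < M.N, Measurable (M.c k)) (hcN : Measurable M.cN) {d : M.MarkovPolicy}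
    (hW : ∀ n ≤ M.N, ∃ C, Bounded bl bu (robustIteration d n) C) {γ : M.MarkovNaturePolicy}
    {δ : ℝ} (hγ : ∀ n < M.N, ∀ xa, ∀ Q : M.𝒬 n, M.L n (robustIteration d (n + 1)) xa Q.1 - δ ≤
      M.L n (robustIteration d (n + 1)) xa (γ.rule n xa).1)
    {n : ℕ} (hn : n ≤ M.N) (x : E) :
    robustIteration d n x - ((M.N : ℝ) - n) * δ ≤ J d γ n x := by
  refine Nat.decreasingInduction'
    (P := fun n => ∀ x, robustIteration d n x - ((M.N : ℝ) - n) * δ ≤ J d γ n x)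
    (fun k hk _ ih x => ?_) hn (fun x => by rw [J_horizon, robustIteration_horizon]; simp) x
  obtain ⟨C, hC⟩ := hW (k + 1) hk
  obtain ⟨C', hC'⟩ := hb.bounded_J hc hcN d γ (k + 1) hk
  have : Nonempty (M.𝒬 k) := (M.nonempty_𝒬 k).to_subtype
  have h1 : robustIteration d k x - δ ≤
      M.L k (robustIteration d (k + 1)) (d.pair k x) (γ.rule k (d.pair k x)).1 := by
    rw [robustIteration_of_lt d hk, sub_le_iff_le_add]
    exact ciSup_le fun Q => sub_le_iff_le_add.1 (hγ k hk (d.pair k x) Q)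
  have h2 : M.L k (robustIteration d (k + 1)) (d.pair k x) (γ.rule k (d.pair k x)).1 -
      ((M.N : ℝ) - (k + 1 : ℕ)) * δ ≤ J d γ k x := by
    have hint := hb.integrable_stageCost hk (hc k hk) hC (d.pair k x) (γ.rule k (d.pair k x)).1
    -- Nature's measure has mass one, so the loss from later stages can be moved under the integral
    -- and compared pointwise.
    have h3 : M.L k (robustIteration d (k + 1)) (d.pair k x) (γ.rule k (d.pair k x)).1 -
        ((M.N : ℝ) - (k + 1 : ℕ)) * δ = ∫ z, (M.stageCost k (robustIteration d (k + 1)) (d.pair k x) z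
          - ((M.N : ℝ) - (k + 1 : ℕ)) * δ) ∂(γ.rule k (d.pair k x)).1.toMeasure := by
      rw [integral_sub hint (integrable_const _), integral_const, probReal_univ, one_smul]
      rfl
    rw [h3, J_of_lt d γ hk]
    refine integral_mono (hint.sub (integrable_const _))
      (hb.integrable_stageCost hk (hc k hk) hC' _ _) fun z => ?_
    have := ih (M.T k (d.pair k x, z))
    simp only [stageCost]
    linarith
  push_cast at h2
  linarith

/-- The rule is the selector on L^p composed with the class of the stage cost. The value δ = 0
covers exact maximizers. -/
theorem exists_rule_of_selector (hq : 1 < q) (hb : M.BoundingFunctions α bl bu) {n : ℕ}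
    (hn : n < M.N) (hc : Measurable (M.c n)) {v : E → ℝ} {C : ℝ} (hv : Bounded bl bu v C)
    [IsSeparable (M.P n)] [MeasurableSpace (Lp ℝ q.conjExponent (M.P n))]
    [BorelSpace (Lp ℝ q.conjExponent (M.P n))] {δ : ℝ}
    (hS : ∃ S : Lp ℝ q.conjExponent (M.P n) → M.𝒬 n, Measurable S ∧
      ∀ Y, ∀ Q : M.𝒬 n, Q.1.pairing Y - δ ≤ (S Y).1.pairing Y) :
    ∃ r : M.D n → M.𝒬 n, Measurable r ∧
      ∀ xa, ∀ Q : M.𝒬 n, M.L n v xa Q.1 - δ ≤ M.L n v xa (r xa).1 := by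
  obtain ⟨S, h1, h2⟩ := hS
  refine ⟨_, h1.comp (hb.measurable_toLp_stageCost hq hn hc hv), fun xa Q => ?_⟩
  rw [hb.L_eq_pairing hn hc hv, hb.L_eq_pairing hn hc hv]
  exact h2 _ Q

end BoundingFunctions

end RobustValue

end RobustMDP

/-! ### The main theorem -/

theorem mainTheorem8 {E A Z : Type*}
    [TopologicalSpace E] [TopologicalSpace.MetrizableSpace E] [SecondCountableTopology E]
    [MeasurableSpace E] [BorelSpace E] [StandardBorelSpace E]
    [TopologicalSpace A] [TopologicalSpace.MetrizableSpace A] [SecondCountableTopology A]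
    [MeasurableSpace A] [BorelSpace A] [StandardBorelSpace A]
    [MeasurableSpace Z] (q : ℝ≥0∞) (hq : 1 < q) (M : RobustMDP E A Z q)
    (hsep : ∀ n < M.N, MeasureTheory.IsSeparable (M.P n))
    (hcont : M.ContinuityCompactness)
    (hint : ∃ (α : ℝ) (bl bu : E → ℝ), M.BoundingFunctions α bl bu)
    (hbdd : M.NormBounded)
    (d : M.MarkovPolicy) :
    -- the values are well defined: the costs are integrable and the suprema are finite
    (∀ n ≤ M.N, ∀ h : M.Hist n,
      (∀ γ : M.NaturePolicy, Integrable (fun h' => h'.cost n)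
        (RobustMDP.law d.toRandomized γ n (M.N - n) h)) ∧
      BddAbove (Set.range fun γ : M.NaturePolicy => RobustMDP.V d.toRandomized γ n h)) ∧
    (∀ n ≤ M.N, ∀ x,
      BddAbove (Set.range fun γ : M.MarkovNaturePolicy => RobustMDP.J d γ n x)) ∧
    (∀ n < M.N, ∀ x,
      (∀ Q ∈ M.𝒬 n, Integrable (M.stageCost n (RobustMDP.robustJ d (n + 1)) (d.pair n x))
        Q.toMeasure) ∧
      BddAbove (Set.range fun Q : M.𝒬 n =>
        M.L n (RobustMDP.robustJ d (n + 1)) (d.pair n x) Q.1)) ∧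
    -- `J_{nπγ}` is the value `V_{nπγ}` of the pair of Markov policies
    (∀ n ≤ M.N, ∀ (γ : M.MarkovNaturePolicy) (h : M.Hist n),
      RobustMDP.J d γ n h.last = RobustMDP.V d.toRandomized γ.toNature n h) ∧
    -- `J_{nπ}(x_n) = V_{nπ}(h_n)`
    (∀ n ≤ M.N, ∀ h : M.Hist n,
      RobustMDP.robustJ d n h.last = RobustMDP.robustV d.toRandomized n h) ∧
    -- robust value iteration
    (∀ n < M.N, ∀ x,
      RobustMDP.robustJ d n x = RobustMDP.opRobust d n (RobustMDP.robustJ d (n + 1)) x) ∧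
    -- an `ε`-optimal Markov policy of nature
    (∀ ε : ℝ, 0 < ε → ∃ γ : M.MarkovNaturePolicy, ∀ n ≤ M.N,
      (∀ x, RobustMDP.robustJ d n x - ε ≤ RobustMDP.J d γ n x) ∧
      ∀ h : M.Hist n, RobustMDP.robustV d.toRandomized n h - ε ≤
        RobustMDP.V d.toRandomized γ.toNature n h) ∧
    -- an optimal Markov policy of nature, if the ambiguity sets are weak* closed
    (M.WeakStarClosed → ∃ γ : M.MarkovNaturePolicy, ∀ n ≤ M.N,
      (∀ x, RobustMDP.J d γ n x = RobustMDP.robustJ d n x) ∧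
      ∀ h : M.Hist n, RobustMDP.V d.toRandomized γ.toNature n h =
        RobustMDP.robustV d.toRandomized n h) := by
  have hq1 : Fact (1 ≤ q) := ⟨hq.le⟩
  obtain ⟨α, bl, bu, hb⟩ := hint
  -- Lower semicontinuous functions are Borel measurable.
  have hc : ∀ k < M.N, Measurable (M.c k) := fun k hk => (hcont.lsc_c k hk).measurable
  have hcN : Measurable M.cN := hcont.lsc_cN.measurable
  have hW := hb.bounded_robustIteration hq hc hcN hsep hbdd d
  obtain ⟨K, hK⟩ := hbdd
  have hV : ∀ γ : M.NaturePolicy, ∀ {n : ℕ}, n ≤ M.N → ∀ h : M.Hist n,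
      RobustMDP.V d.toRandomized γ n h ≤ RobustMDP.robustIteration d n h.last :=
    hb.V_le_robustIteration hc hW
  have hJ : ∀ γ : M.MarkovNaturePolicy, ∀ {n : ℕ}, n ≤ M.N → ∀ x,
      RobustMDP.J d γ n x ≤ RobustMDP.robustIteration d n x :=
    hb.J_le_robustIteration hc hcN hW
  have hJV : ∀ γ : M.MarkovNaturePolicy, ∀ {n : ℕ}, n ≤ M.N → ∀ h : M.Hist n,
      RobustMDP.J d γ n h.last = RobustMDP.V d.toRandomized γ.toNature n h :=
    hb.J_eq_V hc hcN d
  have hbddJ : ∀ n ≤ M.N, ∀ x,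
      BddAbove (Set.range fun γ : M.MarkovNaturePolicy => RobustMDP.J d γ n x) := by
    intro n hn x
    exact ⟨_, Set.forall_mem_range.2 fun γ => hJ γ hn x⟩
  have hbddV : ∀ n ≤ M.N, ∀ h : M.Hist n,
      BddAbove (Set.range fun γ : M.NaturePolicy => RobustMDP.V d.toRandomized γ n h) := by
    intro n hn h
    exact ⟨_, Set.forall_mem_range.2 fun γ => hV γ hn h⟩
  have heps : ∀ ε : ℝ, 0 < ε → ∃ γ : M.MarkovNaturePolicy, ∀ n ≤ M.N, ∀ x,
      RobustMDP.robustIteration d n x - ε ≤ RobustMDP.J d γ n x := by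
    intro ε hε
    -- At most N stages remain, so the total loss is at most ε; N + 1 covers N = 0.
    have hδ : 0 < ε / (M.N + 1) := by positivity
    obtain ⟨γ, hγ⟩ := RobustMDP.exists_markovNaturePolicy (M := M)
      (p := fun n r => ∀ xa, ∀ Q : M.𝒬 n,
        M.L n (RobustMDP.robustIteration d (n + 1)) xa Q.1 - ε / (M.N + 1) ≤
          M.L n (RobustMDP.robustIteration d (n + 1)) xa (r xa).1) fun n hn => by
      have := hsep n hn
      let _ : MeasurableSpace (Lp ℝ q.conjExponent (M.P n)) := borel _
      have : BorelSpace (Lp ℝ q.conjExponent (M.P n)) := ⟨rfl⟩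
      obtain ⟨C, hC⟩ := hW (n + 1) hn
      exact hb.exists_rule_of_selector hq hn (hc n hn) hC
        (DensityMeasure.exists_measurable_almost_worst hq (M.nonempty_𝒬 n) (hK n hn) hδ)
    refine ⟨γ, fun n hn x => le_trans ?_ (hb.robustIteration_sub_le_J hc hcN hW hγ hn x)⟩
    have h1 : ((M.N : ℝ) - n) * (ε / (M.N + 1)) ≤ (M.N + 1) * (ε / (M.N + 1)) := by
      gcongr
      linarith [(Nat.cast_nonneg n : (0 : ℝ) ≤ n)]
    rw [mul_div_cancel₀ _ (by positivity)] at h1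
    linarith
  have hrJ : ∀ n ≤ M.N, ∀ x, RobustMDP.robustJ d n x = RobustMDP.robustIteration d n x := by
    intro n hn x
    refine le_antisymm (ciSup_le fun γ => hJ γ hn x) (le_of_forall_pos_sub_le fun ε hε => ?_)
    obtain ⟨γ, hγ⟩ := heps ε hε
    exact (hγ n hn x).trans (le_ciSup (hbddJ n hn x) γ)
  have hrV : ∀ n ≤ M.N, ∀ h : M.Hist n,
      RobustMDP.robustV d.toRandomized n h = RobustMDP.robustIteration d n h.last := by
    intro n hn h
    -- A real supremum is bounded by its upper bounds via `ciSup_le` only over a nonempty index set.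
    have : Nonempty M.NaturePolicy := ⟨(Classical.arbitrary M.MarkovNaturePolicy).toNature⟩
    refine le_antisymm (ciSup_le fun γ => hV γ hn h) (le_of_forall_pos_sub_le fun ε hε => ?_)
    obtain ⟨γ, hγ⟩ := heps ε hε
    refine ((hγ n hn h.last).trans_eq (hJV γ hn h)).trans ?_
    exact le_ciSup (hbddV n hn h) γ.toNature
  have hrJ' : ∀ n ≤ M.N, RobustMDP.robustJ d n = RobustMDP.robustIteration d n :=
    fun n hn => funext (hrJ n hn)
  refine ⟨fun n hn h => ⟨fun γ => ?_, hbddV n hn h⟩, hbddJ, fun n hn x => ?_,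
    fun n hn γ h => hJV γ hn h, fun n hn h => by rw [hrJ n hn, hrV n hn], fun n hn x => ?_,
    fun ε hε => ?_, fun hclosed => ?_⟩
  · have hN : n + (M.N - n) ≤ M.N := by omega
    exact hb.integrable_running_add hc d γ hN h (hb.bounded_cN hcN)
  · obtain ⟨C, hC⟩ := hW (n + 1) hn
    rw [hrJ' (n + 1) hn]
    exact ⟨fun Q _ => hb.integrable_stageCost hn (hc n hn) hC _ Q,
      hb.bddAbove_L hn (hc n hn) hC (d.pair n x)⟩
  · rw [hrJ' n hn.le, hrJ' (n + 1) hn, RobustMDP.robustIteration_of_lt d hn]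
  · obtain ⟨γ, hγ⟩ := heps ε hε
    refine ⟨γ, fun n hn => ⟨fun x => ?_, fun h => ?_⟩⟩
    · rw [hrJ n hn]
      exact hγ n hn x
    · rw [hrV n hn, ← hJV γ hn]
      exact hγ n hn h.last
  · obtain ⟨γ, hγ⟩ := RobustMDP.exists_markovNaturePolicy (M := M)
      (p := fun n r => ∀ xa, ∀ Q : M.𝒬 n,
        M.L n (RobustMDP.robustIteration d (n + 1)) xa Q.1 - 0 ≤
          M.L n (RobustMDP.robustIteration d (n + 1)) xa (r xa).1) fun n hn => by
      have := hsep n hn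
      let _ : MeasurableSpace (Lp ℝ q.conjExponent (M.P n)) := borel _
      have : BorelSpace (Lp ℝ q.conjExponent (M.P n)) := ⟨rfl⟩
      obtain ⟨C, hC⟩ := hW (n + 1) hn
      refine hb.exists_rule_of_selector hq hn (hc n hn) hC ?_
      simpa only [sub_zero] using
        DensityMeasure.exists_measurable_worst hq (M.nonempty_𝒬 n) (hK n hn) (hclosed n hn)
    have hopt : ∀ n ≤ M.N, ∀ x, RobustMDP.J d γ n x = RobustMDP.robustIteration d n x :=
      fun n hn x => le_antisymm (hJ γ hn x)
        (by simpa using hb.robustIteration_sub_le_J hc hcN hW hγ hn x)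
    refine ⟨γ, fun n hn => ⟨fun x => ?_, fun h => ?_⟩⟩
    · rw [hrJ n hn, hopt n hn]
    · rw [hrV n hn, ← hJV γ hn, hopt n hn]
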